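/- **Setting.** Let $K\ge 2$ and let $\rho_0,\rho_1,\rho_2\ge 0$ be reals; write $\boldsymbol\varrho=(\rho_0,\rho_1,\rho_2)$. For block length $F$, let $W_{12},W_1,W_2$ be independent, uniformly distributed descriptions of $\lfloor F\rho_0\rfloor$, $\lfloor F\rho_1\rfloor$, $\lfloor F\rho_2\rfloor$ bits: $W_{12}$ is common to two files, and $W_i$ is the private description of file $i$. A *multiple-request (MR) scheme* with cache capacity $M\ge 0$ consists of cache encoders, which store $\lfloor FM\rfloor$ bits $Z_k$, a function of $(W_{12},W_1,W_2)$, at each receiver $k\in\{1,\dots,K\}$; a multicast encoder, which maps a demand $\mathbf d\in\{1,2\}^K$, the cache contents and the descriptions to a binary codeword $Y_{\mathbf d}$ of variable length $L(Y_{\mathbf d})$; and decoders, by which receiver $k$ estimates $(W_{12},W_{d_k})$ from $(\mathbf d,Y_{\mathbf d},Z_k)$. Its error probability is $\max_{\mathbf d}\mathbb P(\text{some receiver } k \text{ does not recover } (W_{12},W_{d_k}) \text{ correctly})$, and its peak rate is $\max_{\mathbf d}\mathbb E[L(Y_{\mathbf d})]/F$. A pair $(R,M)$ is achievable if there are MR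 schemes for cache capacity $M$, one for each $F$, whose error probabilities tend to $0$ and whose peak rates have limit superior at most $R$ as $F\to\infty$. The *MR peak rate-memory function* is $R^*_{MR}(M,\boldsymbol\varrho)=\inf\{R:(R,M)\in\mathcal R\}$, where $\mathcal R$ is the closure of the set of achievable pairs. **The proposed MR scheme.** Let $\gamma_K=\frac1K\min\{\rho_1,\rho_2\}$ and $M^*=\rho_1+\rho_2-2\gamma_K$. The memory given to $W_{12}$ and to $(W_1,W_2)$ is, respectively, $(0,M)$ if $M<M^*$; $(M-M^*,M^*)$ if $M^*\le M<\rho_0+M^*$; and $(\rho_0,\min\{M-\rho_0,\rho_1+\rho_2\})$ if $M\ge\rho_0+M^*$. All receivers cache the same initial part of $W_{12}$, and its remainder is multicast uncoded. The private descriptions are cached and delivered by memory sharing between neighbouring ones of the following four schemes, listed in order of increasing private memory $\mu$. In the second and third, each $W_i$ is cut into one packet $W_i^{(j)}$ of rate $\gamma_K$ for each receiver $j$ and an excess part of rate $\rho_i-K\gamma_K$. 1. $\mu=0$: nothing is cached, and the requested private descriptions are sent. 2. $\mu=\gamma_K$: receiver $k$ caches $W_1^{(k)}\oplus W_2^{(k)}$.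 If both files are requested, the sender sends for each $k$ the packet $W_i^{(k)}$ of the file $i\ne d_k$ and, for each file $i$, the exclusive ors $W_i^{(j)}\oplus W_i^{(k)}$ for consecutive receivers $j,k$ among those requesting $i$. If only one file is requested, all its packets are sent. The excess parts of the requested files are sent as well. 3. $\mu=M^*$: receiver $k$ caches both excess parts and all packets $W_1^{(j)},W_2^{(j)}$ with $j\ne k$; the sender sends $\bigoplus_k W_{d_k}^{(k)}$. 4. $\mu=\rho_1+\rho_2$: everything is cached. At block length $F$, the lengths of the cached pieces and of the packets are rounded down to whole bits, and the leftover bits are treated as uncached. Let $R_{MR}(M,\boldsymbol\varrho)$ be the limit superior as $F\to\infty$ of the peak rate of this scheme. **Theorem.** For every $M\ge 0$ the error probability of the proposed scheme tends to $0$ and its peak rate converges to $R_{MR}(M,\boldsymbol\varrho)$ as $F\to\infty$; in particular $R_{MR}(M,\boldsymbol\varrho)\ge R^*_{MR}(M,\boldsymbol\varrho)$. If $$M\in\Big[0,\tfrac1K\min\{\rho_1,\rho_2\}\Big]\cup\Big[\rho_0+\rho_1+\rho_2-\tfrac2K\min\{\rho_1,\rho_2\},\ \rho_0+\rho_1+\rho_2\Big],$$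 then the scheme is optimal among all MR schemes: $R_{MR}(M,\boldsymbol\varrho)=R^*_{MR}(M,\boldsymbol\varrho)$. For all other $M\ge0$, $$R_{MR}(M,\boldsymbol\varrho)-R^*_{MR}(M,\boldsymbol\varrho)\le\Big(\tfrac12-\tfrac1K\Big)\min\{\rho_1,\rho_2\}.$$ In particular, if $K=2$, then $R_{MR}(M,\boldsymbol\varrho)=R^*_{MR}(M,\boldsymbol\varrho)$ for every $M\ge 0$. -/

import Mathlib

open Filter Topology

namespace MRCaching

/-- Binary words of length `n`; there are `2 ^ n` of them. -/
abbrev Bits (n : ℕ) : Type := Fin n → Bool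

/-- The rates of the common description `W₁₂` and of the two private descriptions `W₁`, `W₂`
(in bits per source symbol). -/
structure RateTuple where
  rho0 : ℝ
  rho1 : ℝ
  rho2 : ℝ

/-- The rate of the private description of file `i`; the two files are indexed by `Fin 2`. -/
def RateTuple.priv (ρ : RateTuple) : Fin 2 → ℝ := ![ρ.rho1, ρ.rho2]

/-- The number of bits in `F * r`, rounded down: a message of rate `r` at block length `F` is an
element of a set with `2 ^ ⌊F r⌋` elements. -/
noncomputable def nbits (F : ℕ) (r : ℝ) : ℕ := ⌊(F : ℝ) * r⌋₊

/-- The triple of descriptions `(W₁₂, (W₁, W₂))` at block length `F`. -/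
abbrev Library (ρ : RateTuple) (F : ℕ) : Type :=
  Bits (nbits F ρ.rho0) × ((i : Fin 2) → Bits (nbits F (ρ.priv i)))

/-- A demand vector: receiver `k` requests file `d k`. -/
abbrev Demand (K : ℕ) : Type := Fin K → Fin 2

/-! ### Multiple-request schemes and the rate-memory function -/

/-- A multiple-request scheme for two files and `K` receivers with cache capacity `M` at block
length `F`: cache encoders, a multicast encoder producing binary codewords of variable length, and
decoders. Receiver `k` has to recover the common description and the private description of the
file it requests. -/
structure MRScheme (K : ℕ) (M : ℝ) (ρ : RateTuple) (F : ℕ) where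
  cacheEnc : Fin K → Library ρ F → Bits (nbits F M)
  multicastEnc : Demand K → (Fin K → Bits (nbits F M)) → Library ρ F → List Bool
  decoder : (k : Fin K) → (d : Demand K) → List Bool → Bits (nbits F M) →
    Bits (nbits F ρ.rho0) × Bits (nbits F (ρ.priv (d k)))

namespace MRScheme

variable {K : ℕ} {M : ℝ} {ρ : RateTuple} {F : ℕ}

/-- The multicast codeword sent for demand `d` when the descriptions are `w`. -/
def codeword (S : MRScheme K M ρ F) (d : Demand K) (w : Library ρ F) : List Bool :=
  S.multicastEnc d (fun k => S.cacheEnc k w) w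

/-- For demand `d` and descriptions `w`, some receiver fails to recover its descriptions. -/
def Fails (S : MRScheme K M ρ F) (d : Demand K) (w : Library ρ F) : Prop :=
  ∃ k, S.decoder k d (S.codeword d w) (S.cacheEnc k w) ≠ (w.1, w.2 (d k))

/-- The worst-case (over demands) probability of error; the descriptions are independent and
uniformly distributed, i.e. the library is uniform on the finite type `Library ρ F`. -/
noncomputable def errorProb (S : MRScheme K M ρ F) : ℝ :=
  ⨆ d : Demand K, (Nat.card {w : Library ρ F // S.Fails d w} : ℝ) / Nat.card (Library ρ F)

/-- The peak multicast rate: the largest (over demands) expected codeword length, divided by `F`. -/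
noncomputable def peakRate (S : MRScheme K M ρ F) : ℝ :=
  ⨆ d : Demand K,
    ((∑ w : Library ρ F, ((S.codeword d w).length : ℝ)) / Nat.card (Library ρ F)) / F

end MRScheme

/-- The pair `(R, M)` is an achievable MR peak rate-memory pair. -/
def Achievable (K : ℕ) (ρ : RateTuple) (R M : ℝ) : Prop :=
  0 ≤ M ∧ ∃ S : (F : ℕ) → MRScheme K M ρ F,
    Tendsto (fun F => (S F).errorProb) atTop (𝓝 0) ∧
    limsup (fun F => ((S F).peakRate : EReal)) atTop ≤ (R : EReal)

/-- The MR peak rate-memory region. -/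
def region (K : ℕ) (ρ : RateTuple) : Set (ℝ × ℝ) :=
  closure {p : ℝ × ℝ | Achievable K ρ p.1 p.2}

/-- The MR peak rate-memory function `R*_MR(M, ρ)`. -/
noncomputable def optimalPeakRate (K : ℕ) (M : ℝ) (ρ : RateTuple) : ℝ :=
  sInf {R : ℝ | (R, M) ∈ region K ρ}

/-! ### The proposed scheme: placement and delivery at the level of bits

The common description is cached uncoded, its first `c` bits at every receiver, and the rest is
multicast. The private description of file `i` is cut into

* `K` packets of `a` bits, one per receiver, which are cached in coded form,
* `K` packets of `q` bits, one per receiver, which are cached uncoded by all other receivers,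
* `v i` bits which are cached uncoded by every receiver,
* the remaining bits, which are not cached. -/

/-- The lengths (in bits) of the pieces described above. -/
structure Split where
  c : ℕ
  a : ℕ
  q : ℕ
  v : Fin 2 → ℕ

/-- The `len` bits of `l` that follow the first `start` bits. -/
def slice (l : List Bool) (start len : ℕ) : List Bool := (l.drop start).take len

/-- Bitwise exclusive or. -/
def xorBits (l l' : List Bool) : List Bool := List.zipWith xor l l'

section Bitwise

variable {K : ℕ} (s : Split) (W0 : List Bool) (W : Fin 2 → List Bool)

/-- The packet of file `i` belonging to receiver `j`, in the part that is cached coded. -/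
def codedPacket (i : Fin 2) (j : Fin K) : List Bool := slice (W i) (j * s.a) s.a

/-- The packet of file `i` belonging to receiver `j`, in the part that is cached uncoded. -/
def uncodedPacket (i : Fin 2) (j : Fin K) : List Bool := slice (W i) (K * s.a + j * s.q) s.q

/-- The part of file `i` that is cached by every receiver. -/
def fullyCached (K : ℕ) (i : Fin 2) : List Bool := slice (W i) (K * s.a + K * s.q) (s.v i)

/-- The part of file `i` that is not cached. -/
def uncached (K : ℕ) (i : Fin 2) : List Bool := (W i).drop (K * s.a + K * s.q + s.v i)

/-- The content of the cache of receiver `k`. -/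
def cacheBits (k : Fin K) : List Bool :=
  W0.take s.c
  ++ xorBits (codedPacket s W 0 k) (codedPacket s W 1 k)
  ++ ((List.finRange K).filter (· ≠ k)).flatMap
      (fun j => uncodedPacket s W 0 j ++ uncodedPacket s W 1 j)
  ++ fullyCached s W K 0 ++ fullyCached s W K 1

/-- Some receiver requests file `i`. -/
abbrev Requested (d : Demand K) (i : Fin 2) : Prop := ∃ k, d k = i

/-- Delivery of the part that is cached coded. If both files are requested, then for each receiver
its packet of the file that it does not request is sent (which lets it decode its cache), and for
each file the packets of the receivers requesting it are exchanged through the exclusive ors of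
consecutive ones. If only one file is requested, its packets are sent uncoded. -/
def codedDelivery (d : Demand K) : List Bool :=
  if ∀ i, Requested d i then
    (List.finRange K).flatMap (fun k => codedPacket s W (1 - d k) k)
    ++ [0, 1].flatMap (fun i : Fin 2 =>
        let G := (List.finRange K).filter (fun k => d k = i)
        (List.zipWith (fun j k => xorBits (codedPacket s W i j) (codedPacket s W i k))
          G G.tail).flatten)
  else
    [0, 1].flatMap (fun i : Fin 2 =>
      if Requested d i then (List.finRange K).flatMap (fun k => codedPacket s W i k) else [])

/-- Delivery of the part that is cached uncoded: the exclusive or over all receivers of the only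
packet of the requested file which that receiver misses. -/
def uncodedDelivery (d : Demand K) : List Bool :=
  (List.finRange K).foldr (fun k acc => xorBits (uncodedPacket s W (d k) k) acc)
    (List.replicate s.q false)

/-- The multicast codeword for demand `d`. -/
def sentBits (d : Demand K) : List Bool :=
  W0.drop s.c ++ codedDelivery s W d ++ uncodedDelivery s W d
  ++ [0, 1].flatMap (fun i : Fin 2 => if Requested d i then uncached s W K i else [])

end Bitwise

/-! ### The proposed scheme: allocation of the memory -/

/-- `γ_K = min {ρ₁, ρ₂} / K`. -/
noncomputable def gam (K : ℕ) (ρ : RateTuple) : ℝ := min ρ.rho1 ρ.rho2 / K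

/-- The cache encoder threshold `M* = ρ₁ + ρ₂ - (2 / K) min {ρ₁, ρ₂}`, up to which the rate needed
for the private descriptions decreases with slope at least one in absolute value. -/
noncomputable def threshold (K : ℕ) (ρ : RateTuple) : ℝ := ρ.rho1 + ρ.rho2 - 2 * gam K ρ

/-- The memory given to the common description. -/
noncomputable def commonMem (K : ℕ) (M : ℝ) (ρ : RateTuple) : ℝ :=
  if M < threshold K ρ then 0
  else if M < ρ.rho0 + threshold K ρ then M - threshold K ρ
  else ρ.rho0

/-- The memory given to the private descriptions. -/
noncomputable def privateMem (K : ℕ) (M : ℝ) (ρ : RateTuple) : ℝ :=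
  if M < threshold K ρ then M
  else if M < ρ.rho0 + threshold K ρ then threshold K ρ
  else min (M - ρ.rho0) (ρ.rho1 + ρ.rho2)

/-- Memory sharing for the private descriptions, at private memory `μ`, among the four schemes

* nothing is cached (memory `0`, rate `ρ₁ + ρ₂`),
* coded placement (memory `γ_K`, rate `ρ₁ + ρ₂ - 2 γ_K`),
* uncoded placement (memory `M*`, rate `γ_K`),
* everything is cached (memory `ρ₁ + ρ₂`, rate `0`).

The result is the triple of the fractions of the two files that are handled by the second, the
third and the fourth of them; the remaining fraction is handled by the first. -/
noncomputable def weights (K : ℕ) (ρ : RateTuple) (μ : ℝ) : ℝ × ℝ × ℝ :=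
  if μ < gam K ρ then (μ / gam K ρ, 0, 0)
  else if μ < threshold K ρ then
    let t := (μ - gam K ρ) / (threshold K ρ - gam K ρ)
    (1 - t, t, 0)
  else
    let t := (μ - threshold K ρ) / (2 * gam K ρ)
    (0, 1 - t, t)

/-- The lengths of the pieces for cache capacity `M` at block length `F`. Under either coded or
uncoded placement the packets have rate `γ_K` each, and the excess `ρᵢ - K γ_K` of file `i` is
uncached under coded placement and cached by every receiver under uncoded placement. -/
noncomputable def proposedSplit (K : ℕ) (M : ℝ) (ρ : RateTuple) (F : ℕ) : Split :=
  let θ := weights K ρ (privateMem K M ρ)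
  { c := nbits F (commonMem K M ρ)
    a := nbits F (θ.1 * gam K ρ)
    q := nbits F (θ.2.1 * gam K ρ)
    v := fun i => nbits F (θ.2.1 * (ρ.priv i - K * gam K ρ) + θ.2.2 * ρ.priv i) }

/-- The proposed MR scheme. The cache content is padded with zeros to `⌊F M⌋` bits. A receiver
decodes to descriptions that are consistent with its cache content and the received codeword. -/
noncomputable def proposedScheme (K : ℕ) (M : ℝ) (ρ : RateTuple) (F : ℕ) : MRScheme K M ρ F :=
  let s := proposedSplit K M ρ F
  let cache : Fin K → Library ρ F → Bits (nbits F M) := fun k w j =>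
    (cacheBits s (List.ofFn w.1) (fun i => List.ofFn (w.2 i)) k).getD j false
  let send : Demand K → Library ρ F → List Bool := fun d w =>
    sentBits s (List.ofFn w.1) (fun i => List.ofFn (w.2 i)) d
  { cacheEnc := cache
    multicastEnc := fun d _ w => send d w
    decoder := fun k d y z => Classical.epsilon
      (fun x => ∃ w : Library ρ F, cache k w = z ∧ send d w = y ∧ x = (w.1, w.2 (d k))) }

/-- The peak rate `R_MR(M, ρ)` of the proposed MR scheme. -/
noncomputable def proposedPeakRate (K : ℕ) (M : ℝ) (ρ : RateTuple) : ℝ :=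
  limsup (fun F => (proposedScheme K M ρ F).peakRate) atTop

end MRCaching

/-! Write L = ρ₀ + ρ₁ + ρ₂ and m = min {ρ₁, ρ₂}. The scheme never errs, and its limiting rate is
piecewise linear in M: L - 2M up to γ_K, then L - γ_K - M up to ρ₀ + M*, then (L - M)/2 until it
vanishes at M = L. The converse consists of the bounds collected in `RateBounds`. The cut-set bounds
R + 2M ≥ L and 2R + M ≥ L are met with equality by the two outer pieces. The bound 2R + 2M ≥ 2L - m
is parallel to the middle piece and lies m/2 - m/K below it, which is the gap of the theorem and is
zero for K = 2.

The third bound is submodularity of entropy. Let receivers k and l decode the same file i, from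
transmissions Y and Y' respectively, where in the first one l requests the other file. Then (Z_k, Y)
and (Z_l, Y') both determine (W₁₂, W_i), and jointly they determine the library, so their entropies
add up to at least that of the library plus that of (W₁₂, W_i).

Two technical points replace the usual tools. Codewords need not be prefix-free, so their entropy is
bounded through Gibbs' inequality with weights r ^ (-length), r > 2, at the cost of a constant log
(r / (r - 2)); r tends to 2 only after F tends to infinity. Instead of Fano's inequality, `flagged`
turns a scheme with errors into one without, and lengthens the mean codeword by only o(F).

For achievability, the decoder picks any consistent descriptions, so it suffices that cache and
codeword determine the requested ones (`eq_of_cacheBits_eq_of_sentBits_eq`). Codeword lengths are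
deterministic and largest when both files are requested, which gives the peak rate exactly. -/

namespace MRCaching

/-! ### Entropy of a function on a finite uniform probability space -/

section Entropy

open Finset Classical

variable {Ω α β γ : Type*} [Fintype Ω]

/-- The number of points at which `f` takes the same value as at `ω`. -/
noncomputable def fiberCard (f : Ω → α) (ω : Ω) : ℕ := #{x | f x = f ω}

/-- The Shannon entropy, in nats, of `f` under the uniform distribution on `Ω`. -/
noncomputable def entropy (f : Ω → α) : ℝ :=
  (∑ ω, Real.log (Fintype.card Ω / fiberCard f ω)) / Fintype.card Ω

theorem fiberCard_pos (f : Ω → α) (ω : Ω) : 0 < fiberCard f ω :=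
  Finset.card_pos.2 ⟨ω, by simp⟩

theorem fiberCard_congr (f : Ω → α) {ω ω' : Ω} (h : f ω = f ω') :
    fiberCard f ω = fiberCard f ω' := by
  simp [fiberCard, h]

theorem entropy_of_injective {f : Ω → α} (hf : Function.Injective f) [Nonempty Ω] :
    entropy f = Real.log (Fintype.card Ω) := by
  have h (ω : Ω) : fiberCard f ω = 1 := by
    rw [fiberCard, card_eq_one]
    exact ⟨ω, by ext; simp [hf.eq_iff]⟩
  simp [entropy, h]

theorem entropy_const [Nonempty Ω] (a : α) : entropy (fun _ : Ω => a) = 0 := by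
  have : (Fintype.card Ω : ℝ) ≠ 0 := by positivity
  simp [entropy, fiberCard, this]

/-- Gibbs' inequality. -/
theorem entropy_le_of_sum_le [Nonempty Ω] (f : Ω → α) (Q : α → ℝ) (hQ : ∀ a, 0 < Q a) (C : ℝ)
    (hC : ∑ a ∈ univ.image f, Q a ≤ C) :
    entropy f ≤ (∑ ω, -Real.log (Q (f ω))) / Fintype.card Ω + Real.log C := by
  have hN : (0 : ℝ) < Fintype.card Ω := by positivity
  have hCpos : 0 < C := by
    obtain ⟨ω⟩ := ‹Nonempty Ω›
    exact (hQ (f ω)).trans_le ((single_le_sum (f := Q) (fun a _ => (hQ a).le)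
      (mem_image_of_mem f (mem_univ ω))).trans hC)
  -- Each value is counted once per point of its fiber, and the division by the fiber size undoes
  -- this.
  have hsum : ∑ ω, Q (f ω) / fiberCard f ω = ∑ a ∈ univ.image f, Q a := by
    rw [← sum_fiberwise_of_maps_to (s := univ) (t := univ.image f) (g := f)
      (fun x hx => mem_image_of_mem f hx)]
    refine sum_congr rfl fun a ha => ?_
    obtain ⟨ω₀, -, rfl⟩ := mem_image.1 ha
    have : ∀ ω ∈ ({ω | f ω = f ω₀} : Finset Ω),
        Q (f ω) / fiberCard f ω = Q (f ω₀) / fiberCard f ω₀ := fun ω hω => by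
      have h : f ω = f ω₀ := by simpa using hω
      rw [fiberCard_congr f h, h]
    rw [sum_congr rfl this, sum_const, nsmul_eq_mul]
    have h := fiberCard_pos f ω₀
    rw [show #({ω | f ω = f ω₀} : Finset Ω) = fiberCard f ω₀ from rfl]
    field_simp
  -- This is log x ≤ x - 1 at the ratio of Q / C to the distribution of `f`; the mean of that ratio
  -- is at most one.
  have hterm (ω : Ω) : Real.log (Fintype.card Ω / fiberCard f ω)
      ≤ -Real.log (Q (f ω)) + Real.log C
        + (Fintype.card Ω / C * (Q (f ω) / fiberCard f ω) - 1) := by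
    have hc : (0 : ℝ) < fiberCard f ω := by exact_mod_cast fiberCard_pos f ω
    have hq := hQ (f ω)
    have h := Real.log_le_sub_one_of_pos
      (show 0 < Fintype.card Ω / C * (Q (f ω) / fiberCard f ω) by positivity)
    rw [Real.log_mul (by positivity) (by positivity), Real.log_div hN.ne' hCpos.ne',
      Real.log_div hq.ne' hc.ne'] at h
    rw [Real.log_div hN.ne' hc.ne']
    linarith
  have htot := sum_le_sum fun ω (_ : ω ∈ univ) => hterm ω
  rw [sum_add_distrib, sum_add_distrib, sum_sub_distrib, ← mul_sum, hsum] at htot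
  have hle : Fintype.card Ω / C * ∑ a ∈ univ.image f, Q a ≤ Fintype.card Ω := by
    rw [div_mul_eq_mul_div, div_le_iff₀ hCpos]
    gcongr
  simp only [sum_const, card_univ, nsmul_eq_mul, mul_one] at htot
  unfold entropy
  rw [div_add' _ _ _ hN.ne']
  gcongr
  linarith

theorem entropy_le_log_card [Nonempty Ω] [Fintype α] (f : Ω → α) :
    entropy f ≤ Real.log (Fintype.card α) := by
  have h := entropy_le_of_sum_le f (fun _ => 1) (fun _ => one_pos) (Fintype.card α)
    (by simpa using card_le_univ (univ.image f))
  simpa using h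

/-- Submodularity: `h` is a common function of `p` and `q`. -/
theorem entropy_submodular [Nonempty Ω] (p : Ω → α) (q : Ω → β) (h : Ω → γ)
    (hp : ∀ ω ω', p ω = p ω' → h ω = h ω') (hq : ∀ ω ω', q ω = q ω' → h ω = h ω') :
    entropy (fun ω => (p ω, q ω)) + entropy h ≤ entropy p + entropy q := by
  set pq := fun ω => (p ω, q ω) with hpq
  have hN : (0 : ℝ) < Fintype.card Ω := by positivity
  have pos_h (ω : Ω) : (0 : ℝ) < fiberCard h ω := by exact_mod_cast fiberCard_pos h ω
  have pos_p (ω : Ω) : (0 : ℝ) < fiberCard p ω := by exact_mod_cast fiberCard_pos p ω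
  have pos_q (ω : Ω) : (0 : ℝ) < fiberCard q ω := by exact_mod_cast fiberCard_pos q ω
  have pos_pq (ω : Ω) : (0 : ℝ) < fiberCard pq ω := by exact_mod_cast fiberCard_pos pq ω
  -- This ratio is what log x ≤ x - 1 is applied to. To see that its mean is at most one, the
  -- numerator is expanded as a count of pairs (x, y), and the sum over ω is then taken first.
  have hexp (ω : Ω) : (fiberCard p ω : ℝ) * fiberCard q ω / (fiberCard pq ω * fiberCard h ω)
      = ∑ x, ∑ y, if p x = p ω ∧ q y = q ω then 1 / ((fiberCard pq ω : ℝ) * fiberCard h ω)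
        else 0 := by
    have : (fiberCard p ω : ℝ) * fiberCard q ω
        = ∑ x, ∑ y, if p x = p ω ∧ q y = q ω then 1 else 0 := by
      simp only [fiberCard, card_filter, Nat.cast_sum, sum_mul_sum, Nat.cast_ite, Nat.cast_one,
        Nat.cast_zero, ← ite_and, mul_ite, mul_one, mul_zero]
      refine sum_congr rfl fun x _ => sum_congr rfl fun y _ => ?_
      simp only [and_comm]
    rw [this, sum_div]
    refine sum_congr rfl fun x _ => ?_
    rw [sum_div]
    refine sum_congr rfl fun y _ => ?_
    split_ifs <;> simp
  -- For fixed (x, y) the contributing ω form an empty set or one fiber of (p, q). In the latter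
  -- case they contribute 1 / `fiberCard h x` in total, and h x = h y because h is a function of p
  -- and of q.
  have hinner (x y : Ω) :
      (∑ ω, if p x = p ω ∧ q y = q ω then 1 / ((fiberCard pq ω : ℝ) * fiberCard h ω) else 0)
        ≤ if h y = h x then 1 / (fiberCard h x : ℝ) else 0 := by
    by_cases hex : ∃ ω₀, p x = p ω₀ ∧ q y = q ω₀
    · obtain ⟨ω₀, h1, h2⟩ := hex
      have hx : h x = h ω₀ := hp _ _ h1
      rw [if_pos ((hq _ _ h2).trans hx.symm), fiberCard_congr h hx, ← sum_filter]
      have hcongr : ∀ ω ∈ ({ω | p x = p ω ∧ q y = q ω} : Finset Ω),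
          1 / ((fiberCard pq ω : ℝ) * fiberCard h ω)
            = 1 / ((fiberCard pq ω₀ : ℝ) * fiberCard h ω₀) := fun ω hω => by
        obtain ⟨h3, h4⟩ := (mem_filter.1 hω).2
        rw [fiberCard_congr pq (ω := ω) (ω' := ω₀) (by simp [hpq, ← h1, ← h2, ← h3, ← h4]),
          fiberCard_congr h ((hp _ _ h3).symm.trans hx)]
      have hcard : #({ω | p x = p ω ∧ q y = q ω} : Finset Ω) = fiberCard pq ω₀ := by
        simp only [fiberCard, hpq, Prod.mk.injEq, h1, h2]
        congr 1
        ext ω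
        simp [eq_comm]
      rw [sum_congr rfl hcongr, sum_const, hcard, nsmul_eq_mul]
      have := pos_pq ω₀
      have := pos_h ω₀
      apply le_of_eq
      field_simp
    · rw [sum_eq_zero fun ω _ => if_neg fun hω => hex ⟨ω, hω⟩]
      split_ifs <;> positivity
  have hkey : ∑ ω, (fiberCard p ω : ℝ) * fiberCard q ω / (fiberCard pq ω * fiberCard h ω)
      ≤ Fintype.card Ω := by
    calc _ = ∑ x, ∑ y, ∑ ω, if p x = p ω ∧ q y = q ω then
            1 / ((fiberCard pq ω : ℝ) * fiberCard h ω) else 0 := by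
          rw [sum_congr rfl fun ω _ => hexp ω, sum_comm]
          exact sum_congr rfl fun x _ => sum_comm
      _ ≤ ∑ x, ∑ y, if h y = h x then 1 / (fiberCard h x : ℝ) else 0 :=
          sum_le_sum fun x _ => sum_le_sum fun y _ => hinner x y
      _ = ∑ x : Ω, 1 := by
          refine sum_congr rfl fun x _ => ?_
          rw [← sum_filter, sum_const, nsmul_eq_mul]
          exact mul_one_div_cancel (pos_h x).ne'
      _ = Fintype.card Ω := by simp
  have hterm (ω : Ω) : Real.log (Fintype.card Ω / fiberCard pq ω)
        + Real.log (Fintype.card Ω / fiberCard h ω)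
      ≤ Real.log (Fintype.card Ω / fiberCard p ω) + Real.log (Fintype.card Ω / fiberCard q ω)
        + ((fiberCard p ω : ℝ) * fiberCard q ω / (fiberCard pq ω * fiberCard h ω) - 1) := by
    have a := pos_p ω
    have b := pos_q ω
    have c := pos_pq ω
    have e := pos_h ω
    have hl := Real.log_le_sub_one_of_pos
      (show 0 < (fiberCard p ω : ℝ) * fiberCard q ω / (fiberCard pq ω * fiberCard h ω) by
        positivity)
    rw [Real.log_div (by positivity) (by positivity), Real.log_mul a.ne' b.ne',
      Real.log_mul c.ne' e.ne'] at hl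
    rw [Real.log_div hN.ne' a.ne', Real.log_div hN.ne' b.ne', Real.log_div hN.ne' c.ne',
      Real.log_div hN.ne' e.ne']
    linarith
  have htot := sum_le_sum fun ω (_ : ω ∈ univ) => hterm ω
  rw [sum_add_distrib, sum_add_distrib, sum_add_distrib, sum_sub_distrib] at htot
  simp only [sum_const, card_univ, nsmul_eq_mul, mul_one] at htot
  unfold entropy
  rw [← add_div, ← add_div]
  refine div_le_div_of_nonneg_right ?_ hN.le
  linarith

theorem entropy_prod_le [Nonempty Ω] (p : Ω → α) (q : Ω → β) :
    entropy (fun ω => (p ω, q ω)) ≤ entropy p + entropy q := by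
  have h := entropy_submodular p q (fun _ => ()) (fun _ _ _ => rfl) (fun _ _ _ => rfl)
  rwa [entropy_const, add_zero] at h

/-- There are at most 2 ^ n words of length n, so a geometric series of ratio 2 / r dominates. Since
no prefix condition is available, r = 2 would make the series diverge. -/
theorem sum_pow_length_le (s : Finset (List Bool)) {r : ℝ} (hr : 2 < r) :
    ∑ y ∈ s, (r ^ y.length)⁻¹ ≤ r / (r - 2) := by
  have hr0 : 0 < r := by linarith
  have hcard (n : ℕ) : #{y ∈ s | y.length = n} ≤ 2 ^ n := by
    -- The default value `false` is never read, as the words have length exactly `n`.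
    have hinj := card_le_card_of_injOn (s := {y ∈ s | y.length = n})
      (t := (univ : Finset (Bits n))) (fun y j => y.getD j false) (fun _ _ => by simp) ?_
    · simpa using hinj
    · intro y hy z hz hyz
      have hy' : y.length = n := by simpa using (mem_filter.1 hy).2
      have hz' : z.length = n := by simpa using (mem_filter.1 hz).2
      refine List.ext_getElem (hy'.trans hz'.symm) fun i h1 h2 => ?_
      have := congrFun hyz ⟨i, hy' ▸ h1⟩
      simpa [List.getD_eq_getElem, h1, h2] using this
  have hmaps : ∀ y ∈ s, y.length ∈ range (s.sup List.length + 1) := fun y hy =>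
    mem_range.2 (Nat.lt_succ_of_le (le_sup (f := List.length) hy))
  have hgeo : HasSum (fun n : ℕ => (2 / r) ^ n) (r / (r - 2)) := by
    have h := hasSum_geometric_of_lt_one (r := 2 / r) (by positivity)
      ((div_lt_one hr0).2 hr)
    convert h using 1
    have : r - 2 ≠ 0 := by linarith
    field_simp
  calc ∑ y ∈ s, (r ^ y.length)⁻¹
      = ∑ n ∈ range (s.sup List.length + 1), ∑ y ∈ s with y.length = n, (r ^ y.length)⁻¹ :=
        (sum_fiberwise_of_maps_to hmaps _).symm
    _ ≤ ∑ n ∈ range (s.sup List.length + 1), (2 / r) ^ n := by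
        refine sum_le_sum fun n _ => ?_
        rw [sum_congr rfl fun y hy => by rw [(mem_filter.1 hy).2], sum_const, nsmul_eq_mul,
          div_pow, div_eq_mul_inv]
        gcongr
        exact_mod_cast hcard n
    _ ≤ r / (r - 2) := sum_le_hasSum _ (fun n _ => by positivity) hgeo

/-- The entropy of a variable-length binary word in terms of its expected length. -/
theorem entropy_list_le [Nonempty Ω] (f : Ω → List Bool) {r : ℝ} (hr : 2 < r) :
    entropy f ≤ (∑ ω, ((f ω).length : ℝ)) / Fintype.card Ω * Real.log r
      + Real.log (r / (r - 2)) := by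
  have h := entropy_le_of_sum_le f (fun y => (r ^ y.length)⁻¹)
    (fun y => by have : 0 < r := by linarith
                 positivity) _ (sum_pow_length_le _ hr)
  simpa [Real.log_inv, Real.log_pow, ← sum_mul, mul_div_right_comm] using h

end Entropy

/-! ### Lower bounds on the rate of multiple-request schemes -/

/-- The total number of bits of the three descriptions. -/
noncomputable def libraryBits (ρ : RateTuple) (F : ℕ) : ℕ :=
  nbits F ρ.rho0 + nbits F ρ.rho1 + nbits F ρ.rho2

theorem card_library (ρ : RateTuple) (F : ℕ) :
    Fintype.card (Library ρ F) = 2 ^ libraryBits ρ F := by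
  rw [← Nat.card_eq_fintype_card, Nat.card_prod, Nat.card_pi (β := fun i => Bits _),
    Fin.prod_univ_two]
  simp only [Nat.card_eq_fintype_card, Fintype.card_pi, Fintype.card_bool, Finset.prod_const,
    Finset.card_univ, Fintype.card_fin, libraryBits, pow_add, mul_assoc]
  rfl

theorem log_card_library (ρ : RateTuple) (F : ℕ) :
    Real.log (Fintype.card (Library ρ F)) = libraryBits ρ F * Real.log 2 := by
  rw [card_library, Nat.cast_pow, Real.log_pow, Nat.cast_ofNat]

theorem entropy_bits_le {Ω : Type*} [Fintype Ω] [Nonempty Ω] {n : ℕ} (f : Ω → Bits n) :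
    entropy f ≤ n * Real.log 2 := by
  simpa using entropy_le_log_card f

/-- A list of bits listing the whole library. -/
noncomputable def libraryList {ρ : RateTuple} {F : ℕ} (w : Library ρ F) : List Bool :=
  List.ofFn w.1 ++ (List.ofFn (w.2 0) ++ List.ofFn (w.2 1))

theorem length_libraryList {ρ : RateTuple} {F : ℕ} (w : Library ρ F) :
    (libraryList w).length = libraryBits ρ F := by
  simp only [libraryList, List.length_append, List.length_ofFn, libraryBits, add_assoc]
  rfl

theorem libraryList_injective {ρ : RateTuple} {F : ℕ} :
    Function.Injective (libraryList : Library ρ F → List Bool) := by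
  intro w w' h
  obtain ⟨h0, h⟩ := List.append_inj h (by simp)
  obtain ⟨h1, h2⟩ := List.append_inj h (by simp)
  refine Prod.ext (List.ofFn_injective h0) (funext fun i => ?_)
  fin_cases i
  · exact List.ofFn_injective h1
  · exact List.ofFn_injective h2

namespace MRScheme

variable {K : ℕ} {M : ℝ} {ρ : RateTuple} {F : ℕ} (S : MRScheme K M ρ F)

open Classical in
/-- The codeword preceded by a flag, and replaced by the whole library where decoding fails. -/
noncomputable def flagged (d : Demand K) (w : Library ρ F) : List Bool :=
  if S.Fails d w then true :: libraryList w else false :: S.codeword d w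

/-- The flag tells the two kinds of words apart: an unflagged codeword is decoded correctly, a
flagged one spells out the library. Decoding is thus error-free for every `w`. -/
theorem eq_of_flagged_eq {d : Demand K} {k : Fin K} {w w' : Library ρ F}
    (hZ : S.cacheEnc k w = S.cacheEnc k w') (hY : S.flagged d w = S.flagged d w') :
    w.1 = w'.1 ∧ w.2 (d k) = w'.2 (d k) := by
  unfold flagged at hY
  split_ifs at hY with h h' h'
  · simp only [List.cons.injEq, true_and] at hY
    simp [libraryList_injective hY]
  · simp at hY
  · simp at hY
  · simp only [List.cons.injEq, true_and] at hY
    simp only [Fails, not_exists, not_not] at h h'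
    have := h k
    rw [hZ, hY, h' k] at this
    simpa [eq_comm] using this

theorem failure_le_errorProb (d : Demand K) :
    (Nat.card {w : Library ρ F // S.Fails d w} : ℝ) / Nat.card (Library ρ F) ≤ S.errorProb :=
  le_ciSup (f := fun d => (Nat.card {w : Library ρ F // S.Fails d w} : ℝ) /
    Nat.card (Library ρ F)) (Set.finite_range _).bddAbove d

theorem peakRate_nonneg : 0 ≤ S.peakRate :=
  Real.iSup_nonneg fun _ => by positivity

theorem meanLength_le (hF : 0 < F) (d : Demand K) :
    (∑ w : Library ρ F, ((S.codeword d w).length : ℝ)) / Nat.card (Library ρ F)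
      ≤ F * S.peakRate := by
  rw [← div_le_iff₀' (by positivity)]
  exact le_ciSup (f := fun d => (∑ w : Library ρ F, ((S.codeword d w).length : ℝ)) /
    Nat.card (Library ρ F) / F) (Set.finite_range _).bddAbove d

/-- The flag costs one bit, and the library is appended only on failure, hence with probability at
most `errorProb`. Divided by F, the overhead vanishes for reliable schemes. -/
theorem mean_length_flagged_le (hF : 0 < F) (d : Demand K) :
    (∑ w : Library ρ F, ((S.flagged d w).length : ℝ)) / Fintype.card (Library ρ F)
      ≤ F * S.peakRate + 1 + S.errorProb * libraryBits ρ F := by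
  classical
  have hN : (0 : ℝ) < Fintype.card (Library ρ F) := by positivity
  have hterm (w : Library ρ F) : ((S.flagged d w).length : ℝ)
      ≤ (S.codeword d w).length + 1 + (if S.Fails d w then 1 else 0) * libraryBits ρ F := by
    unfold flagged
    split_ifs
    · simp only [List.length_cons, length_libraryList]
      push_cast
      have : (0 : ℝ) ≤ (S.codeword d w).length := by positivity
      linarith
    · simp
  have hfail : (∑ w : Library ρ F, if S.Fails d w then (1 : ℝ) else 0)
      = Nat.card {w : Library ρ F // S.Fails d w} := by
    rw [Nat.card_eq_fintype_card, Fintype.card_subtype, Finset.sum_boole]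
  have h1 := S.meanLength_le hF d
  have h2 := S.failure_le_errorProb d
  rw [Nat.card_eq_fintype_card (α := Library ρ F)] at h1 h2
  have htot := Finset.sum_le_sum fun w (_ : w ∈ Finset.univ) => hterm w
  rw [Finset.sum_add_distrib, Finset.sum_add_distrib, ← Finset.sum_mul, hfail] at htot
  simp only [Finset.sum_const, Finset.card_univ, nsmul_eq_mul, mul_one] at htot
  rw [div_le_iff₀ hN] at h1 h2 ⊢
  have h3 := mul_le_mul_of_nonneg_right h2 (Nat.cast_nonneg (α := ℝ) (libraryBits ρ F))
  linarith

/-- An upper bound on the entropy of flagged codewords. -/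
noncomputable def codeBound (r : ℝ) : ℝ :=
  (F * S.peakRate + 1 + S.errorProb * libraryBits ρ F) * Real.log r + Real.log (r / (r - 2))

theorem entropy_flagged_le (hF : 0 < F) (d : Demand K) {r : ℝ} (hr : 2 < r) :
    entropy (S.flagged d) ≤ S.codeBound r := by
  refine (entropy_list_le _ hr).trans ?_
  unfold codeBound
  have : 0 ≤ Real.log r := Real.log_nonneg (by linarith)
  gcongr
  exact S.mean_length_flagged_le hF d

variable {S}

/-- Cut-set bound for one receiver and two demands. -/
theorem cutset_one_cache (hK : 0 < K) (hF : 0 < F) {r : ℝ} (hr : 2 < r) :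
    libraryBits ρ F * Real.log 2 ≤ 2 * S.codeBound r + nbits F M * Real.log 2 := by
  let k : Fin K := ⟨0, hK⟩
  have hinj : Function.Injective fun w : Library ρ F =>
      (S.cacheEnc k w, (S.flagged (fun _ => 0) w, S.flagged (fun _ => 1) w)) := by
    intro w w' h
    simp only [Prod.mk.injEq] at h
    obtain ⟨a, b⟩ := S.eq_of_flagged_eq h.1 h.2.1
    obtain ⟨-, c⟩ := S.eq_of_flagged_eq h.1 h.2.2
    refine Prod.ext a (funext fun i => ?_)
    fin_cases i
    · exact b
    · exact c
  have h1 := entropy_of_injective hinj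
  have h2 := entropy_prod_le (fun w : Library ρ F => S.cacheEnc k w)
    (fun w => (S.flagged (fun _ => 0) w, S.flagged (fun _ => 1) w))
  have h3 := entropy_prod_le (S.flagged (fun _ => 0)) (S.flagged (fun _ => 1))
  have h4 := S.entropy_flagged_le hF (fun _ => 0) hr
  have h5 := S.entropy_flagged_le hF (fun _ => 1) hr
  have h6 := entropy_bits_le (fun w : Library ρ F => S.cacheEnc k w)
  rw [log_card_library] at h1
  linarith

theorem injective_two_caches {k l : Fin K} {d : Demand K} (hd : d k ≠ d l) :
    Function.Injective fun w : Library ρ F =>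
      ((S.cacheEnc k w, S.cacheEnc l w), S.flagged d w) := by
  intro w w' h
  simp only [Prod.mk.injEq] at h
  obtain ⟨a, b⟩ := S.eq_of_flagged_eq h.1.1 h.2
  obtain ⟨-, c⟩ := S.eq_of_flagged_eq h.1.2 h.2
  refine Prod.ext a (funext fun i => ?_)
  rcases (by omega : i = d k ∨ i = d l) with rfl | rfl
  · exact b
  · exact c

/-- Cut-set bound for two receivers and one demand. -/
theorem cutset_two_caches (hK : 2 ≤ K) (hF : 0 < F) {r : ℝ} (hr : 2 < r) :
    libraryBits ρ F * Real.log 2 ≤ S.codeBound r + 2 * (nbits F M * Real.log 2) := by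
  let k : Fin K := ⟨0, by omega⟩
  let l : Fin K := ⟨1, by omega⟩
  let d : Demand K := fun j => if j = k then 0 else 1
  have h1 := entropy_of_injective (S.injective_two_caches (k := k) (l := l) (d := d)
    (by simp [d, k, l]))
  have h2 := entropy_prod_le (fun w : Library ρ F => (S.cacheEnc k w, S.cacheEnc l w))
    (S.flagged d)
  have h3 := entropy_prod_le (fun w : Library ρ F => S.cacheEnc k w) (fun w => S.cacheEnc l w)
  have h4 := S.entropy_flagged_le hF d hr
  have h5 := entropy_bits_le (fun w : Library ρ F => S.cacheEnc k w)
  have h6 := entropy_bits_le (fun w : Library ρ F => S.cacheEnc l w)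
  rw [log_card_library] at h1
  linarith

/-- Two receivers decode file `i` from different transmissions. -/
theorem two_transmissions_bound (hK : 2 ≤ K) (hF : 0 < F) {r : ℝ} (hr : 2 < r) (i : Fin 2) :
    (2 * libraryBits ρ F - nbits F (ρ.priv (1 - i))) * Real.log 2
      ≤ 2 * S.codeBound r + 2 * (nbits F M * Real.log 2) := by
  let k : Fin K := ⟨0, by omega⟩
  let l : Fin K := ⟨1, by omega⟩
  let d : Demand K := fun j => if j = k then i else 1 - i
  let d' : Demand K := fun j => if j = l then i else 1 - i
  have hd : d k = i := by simp [d]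
  have hd' : d' l = i := by simp [d']
  have hne : d k ≠ d l := by
    simp only [d, k, l, Fin.mk.injEq, one_ne_zero, if_true, if_false]
    omega
  let h := fun w : Library ρ F => (w.1, w.2 i)
  have hp : ∀ w w' : Library ρ F, (S.cacheEnc k w, S.flagged d w)
      = (S.cacheEnc k w', S.flagged d w') → h w = h w' := fun w w' e => by
    simp only [Prod.mk.injEq] at e
    have := S.eq_of_flagged_eq e.1 e.2
    rw [hd] at this
    exact Prod.ext this.1 this.2
  have hq : ∀ w w' : Library ρ F, (S.cacheEnc l w, S.flagged d' w)
      = (S.cacheEnc l w', S.flagged d' w') → h w = h w' := fun w w' e => by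
    simp only [Prod.mk.injEq] at e
    have := S.eq_of_flagged_eq e.1 e.2
    rw [hd'] at this
    exact Prod.ext this.1 this.2
  have h1 := entropy_submodular (fun w => (S.cacheEnc k w, S.flagged d w))
    (fun w => (S.cacheEnc l w, S.flagged d' w)) h hp hq
  -- Both caches and the first transmission alone already determine the library.
  have h2 := entropy_of_injective (f := fun w : Library ρ F =>
    ((S.cacheEnc k w, S.flagged d w), (S.cacheEnc l w, S.flagged d' w))) fun w w' e => by
      simp only [Prod.mk.injEq] at e
      exact S.injective_two_caches hne (by simp [e.1.1, e.1.2, e.2.1])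
  -- Used to bound the entropy of `h` from below: the library minus the file that `h` omits.
  have h3 := entropy_of_injective (f := fun w : Library ρ F => (h w, w.2 (1 - i)))
    fun w w' e => by
      simp only [h, Prod.mk.injEq] at e
      refine Prod.ext e.1.1 (funext fun m => ?_)
      rcases (by omega : m = i ∨ m = 1 - i) with rfl | rfl
      · exact e.1.2
      · exact e.2
  have h4 := entropy_prod_le h (fun w => w.2 (1 - i))
  have h5 := entropy_bits_le (fun w : Library ρ F => w.2 (1 - i))
  have h6 := entropy_prod_le (fun w : Library ρ F => S.cacheEnc k w) (S.flagged d)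
  have h7 := entropy_prod_le (fun w : Library ρ F => S.cacheEnc l w) (S.flagged d')
  have h8 := S.entropy_flagged_le hF d hr
  have h9 := S.entropy_flagged_le hF d' hr
  have h10 := entropy_bits_le (fun w : Library ρ F => S.cacheEnc k w)
  have h11 := entropy_bits_le (fun w : Library ρ F => S.cacheEnc l w)
  rw [log_card_library] at h2 h3
  linarith

end MRScheme

/-! ### Asymptotic lower bounds -/

theorem tendsto_nbits_div {r : ℝ} (hr : 0 ≤ r) :
    Tendsto (fun F : ℕ => (nbits F r : ℝ) / F) atTop (𝓝 r) := by
  have h := (tendsto_nat_floor_mul_div_atTop hr).comp (tendsto_natCast_atTop_atTop (R := ℝ))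
  refine h.congr fun F => ?_
  simp [nbits, mul_comm]

/-- A linear bound on the parameters of the schemes at every block length passes to the limit. -/
theorem Achievable.linear_bound {K : ℕ} {ρ : RateTuple} {R M : ℝ} (h0 : 0 ≤ ρ.rho0)
    (h1 : 0 ≤ ρ.rho1) (h2 : 0 ≤ ρ.rho2) (h : Achievable K ρ R M) {α β c : ℝ} (hα : 0 ≤ α)
    (n : ℕ → ℝ) (hn : Tendsto (fun F => n F / F) atTop (𝓝 c))
    (hbound : ∀ (F : ℕ) (S : MRScheme K M ρ F) (r : ℝ), 0 < F → 2 < r →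
      n F * Real.log 2 ≤ α * S.codeBound r + β * (nbits F M * Real.log 2)) :
    c ≤ α * R + β * M := by
  obtain ⟨hM, S, herr, hlim⟩ := h
  -- The same ε serves twice: as slack in the limit superior of the peak rate, and to keep r = 2 + ε
  -- above 2. It is sent to 0 only after F has gone to infinity.
  have key (ε : ℝ) (hε : 0 < ε) :
      c * Real.log 2 ≤ α * ((R + ε) * Real.log (2 + ε)) + β * (M * Real.log 2) := by
    have hpeak : ∀ᶠ F in atTop, (S F).peakRate ≤ R + ε := by
      have := eventually_lt_of_limsup_lt (hlim.trans_lt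
        (show (R : EReal) < ((R + ε : ℝ) : EReal) by exact_mod_cast (by linarith)))
      filter_upwards [this] with F hF
      exact (EReal.coe_lt_coe_iff.1 hF).le
    have hlib : Tendsto (fun F : ℕ => (libraryBits ρ F : ℝ) / F) atTop
        (𝓝 (ρ.rho0 + ρ.rho1 + ρ.rho2)) := by
      refine (((tendsto_nbits_div h0).add (tendsto_nbits_div h1)).add
        (tendsto_nbits_div h2)).congr fun F => ?_
      simp only [libraryBits]
      push_cast
      ring
    have hinv : Tendsto (fun F : ℕ => (1 : ℝ) / F) atTop (𝓝 0) :=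
      tendsto_const_div_atTop_nhds_zero_nat 1
    have hR := (((((tendsto_const_nhds (x := R + ε)).add hinv).add (herr.mul hlib)).mul_const
      (Real.log (2 + ε))).add (hinv.const_mul (Real.log ((2 + ε) / (2 + ε - 2))))).const_mul α
    have hM' := ((tendsto_nbits_div hM).mul_const (Real.log 2)).const_mul β
    have := le_of_tendsto_of_tendsto (hn.mul_const (Real.log 2)) (hR.add hM') ?_
    · simpa using this
    filter_upwards [hpeak, eventually_gt_atTop 0] with F hF hpos
    have hFpos : (0 : ℝ) < F := by exact_mod_cast hpos
    have hb := hbound F (S F) (2 + ε) hpos (by linarith)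
    have hlog : 0 ≤ Real.log (2 + ε) := Real.log_nonneg (by linarith)
    have hcb : (S F).codeBound (2 + ε) ≤ (F * (R + ε) + 1 + (S F).errorProb * libraryBits ρ F)
        * Real.log (2 + ε) + Real.log ((2 + ε) / (2 + ε - 2)) := by
      unfold MRScheme.codeBound
      gcongr
    have hb' := hb.trans (add_le_add_left (mul_le_mul_of_nonneg_left hcb hα) _)
    have hdiv := div_le_div_of_nonneg_right hb' hFpos.le
    refine le_trans (le_of_eq ?_) (hdiv.trans (le_of_eq ?_))
    · ring
    · field_simp
  have hcont : Tendsto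
      (fun ε : ℝ => α * ((R + ε) * Real.log (2 + ε)) + β * (M * Real.log 2)) (𝓝[>] 0)
      (𝓝 (α * ((R + 0) * Real.log (2 + 0)) + β * (M * Real.log 2))) := by
    refine tendsto_nhdsWithin_of_tendsto_nhds (ContinuousAt.tendsto ?_)
    fun_prop (disch := norm_num)
  have hlim := ge_of_tendsto hcont (eventually_mem_nhdsWithin.mono fun ε hε => key ε hε)
  have hlog : 0 < Real.log 2 := Real.log_pos one_lt_two
  rw [add_zero, add_zero] at hlim
  refine le_of_mul_le_mul_right (hlim.trans (le_of_eq ?_)) hlog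
  ring

/-- The rate is nonnegative and satisfies the cut-set bounds and the bound obtained from two
receivers decoding the same file from two transmissions. -/
structure RateBounds (ρ : RateTuple) (R M : ℝ) : Prop where
  nonneg : 0 ≤ R
  one_cache : ρ.rho0 + ρ.rho1 + ρ.rho2 ≤ 2 * R + M
  two_caches : ρ.rho0 + ρ.rho1 + ρ.rho2 ≤ R + 2 * M
  two_transmissions : 2 * (ρ.rho0 + ρ.rho1 + ρ.rho2) - min ρ.rho1 ρ.rho2 ≤ 2 * R + 2 * M

theorem Achievable.rateBounds {K : ℕ} (hK : 2 ≤ K) {ρ : RateTuple} {R M : ℝ} (h0 : 0 ≤ ρ.rho0)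
    (h1 : 0 ≤ ρ.rho1) (h2 : 0 ≤ ρ.rho2) (h : Achievable K ρ R M) : RateBounds ρ R M := by
  have t0 := tendsto_nbits_div h0
  have t1 := tendsto_nbits_div h1
  have t2 := tendsto_nbits_div h2
  have tl : Tendsto (fun F : ℕ => (libraryBits ρ F : ℝ) / F) atTop
      (𝓝 (ρ.rho0 + ρ.rho1 + ρ.rho2)) := by
    refine ((t0.add t1).add t2).congr fun F => ?_
    simp only [libraryBits]
    push_cast
    ring
  have two (i : Fin 2) (hi : 0 ≤ ρ.priv (1 - i)) :
      2 * (ρ.rho0 + ρ.rho1 + ρ.rho2) - ρ.priv (1 - i) ≤ 2 * R + 2 * M := by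
    refine h.linear_bound h0 h1 h2 zero_le_two
      (fun F => 2 * libraryBits ρ F - nbits F (ρ.priv (1 - i))) ?_
      fun F S r hF hr => MRScheme.two_transmissions_bound hK hF hr i
    refine ((tl.const_mul 2).sub (tendsto_nbits_div hi)).congr fun F => ?_
    ring
  refine ⟨?_, ?_, ?_, ?_⟩
  · obtain ⟨-, S, -, hlim⟩ := h
    have : (0 : EReal) ≤ limsup (fun F => ((S F).peakRate : EReal)) atTop :=
      le_limsup_of_frequently_le
        (Frequently.of_forall fun F => by exact_mod_cast (S F).peakRate_nonneg)
    exact_mod_cast this.trans hlim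
  · have := h.linear_bound h0 h1 h2 zero_le_two (β := 1) _ tl
      fun F S r hF hr => by
        simpa using MRScheme.cutset_one_cache (S := S) (by omega) hF hr
    linarith
  · have := h.linear_bound h0 h1 h2 zero_le_one (β := 2) _ tl
      fun F S r hF hr => by
        simpa using MRScheme.cutset_two_caches (S := S) hK hF hr
    linarith
  -- The bound is strongest when the file decoded twice is the larger one, so that the smaller one
  -- is subtracted.
  · rcases min_cases ρ.rho1 ρ.rho2 with ⟨hm, -⟩ | ⟨hm, -⟩
    · rw [hm]
      exact two 1 h1
    · rw [hm]
      exact two 0 h2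

/-- The bounds are non-strict and linear in (R, M), hence survive the closure in the definition of
the region. -/
theorem rateBounds_of_mem_region {K : ℕ} (hK : 2 ≤ K) {ρ : RateTuple} {R M : ℝ}
    (h0 : 0 ≤ ρ.rho0) (h1 : 0 ≤ ρ.rho1) (h2 : 0 ≤ ρ.rho2) (h : (R, M) ∈ region K ρ) :
    RateBounds ρ R M := by
  have hclosed : IsClosed {p : ℝ × ℝ | RateBounds ρ p.1 p.2} := by
    have : {p : ℝ × ℝ | RateBounds ρ p.1 p.2} = {p | 0 ≤ p.1}
        ∩ ({p | ρ.rho0 + ρ.rho1 + ρ.rho2 ≤ 2 * p.1 + p.2}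
        ∩ ({p | ρ.rho0 + ρ.rho1 + ρ.rho2 ≤ p.1 + 2 * p.2}
        ∩ {p | 2 * (ρ.rho0 + ρ.rho1 + ρ.rho2) - min ρ.rho1 ρ.rho2 ≤ 2 * p.1 + 2 * p.2})) :=
      Set.ext fun p => ⟨fun h => ⟨h.1, h.2, h.3, h.4⟩, fun h => ⟨h.1, h.2.1, h.2.2.1, h.2.2.2⟩⟩
    rw [this]
    refine .inter ?_ (.inter ?_ (.inter ?_ ?_)) <;>
      exact isClosed_le (by fun_prop) (by fun_prop)
  exact closure_minimal (fun p hp => Achievable.rateBounds hK h0 h1 h2 hp) hclosed h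

/-! ### Lists of bits -/

theorem length_slice {l : List Bool} {m n : ℕ} (h : m + n ≤ l.length) :
    (slice l m n).length = n := by
  simp only [slice, List.length_take, List.length_drop]
  omega

theorem length_xorBits {l l' : List Bool} {n : ℕ} (h : l.length = n) (h' : l'.length = n) :
    (xorBits l l').length = n := by
  simp [xorBits, h, h']

theorem xorBits_comm (l l' : List Bool) : xorBits l l' = xorBits l' l := by
  rw [xorBits, xorBits, List.zipWith_comm]
  congr
  funext a b
  exact Bool.xor_comm b a

theorem eq_of_xorBits_eq {l m m' : List Bool} (hm : m.length = l.length)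
    (hm' : m'.length = l.length) (h : xorBits l m = xorBits l m') : m = m' := by
  refine List.ext_getElem (hm.trans hm'.symm) fun i h1 h2 => ?_
  have hl : i < l.length := hm ▸ h1
  have := List.getElem_of_eq h (i := i) (by simp [xorBits, h1, hl])
  simpa [xorBits] using this

theorem eq_of_xorBits_eq_right {l m m' : List Bool} (hm : m.length = l.length)
    (hm' : m'.length = l.length) (h : xorBits m l = xorBits m' l) : m = m' :=
  eq_of_xorBits_eq hm hm' (by rwa [xorBits_comm l m, xorBits_comm l m'])

theorem length_flatMap_congr {ι : Type*} (l : List ι) {f g : ι → List Bool}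
    (h : ∀ x ∈ l, (f x).length = (g x).length) : (l.flatMap f).length = (l.flatMap g).length := by
  rw [List.length_flatMap, List.length_flatMap, List.map_congr_left h]

theorem length_flatMap_const {ι : Type*} (l : List ι) {f : ι → List Bool} {n : ℕ}
    (h : ∀ x ∈ l, (f x).length = n) : (l.flatMap f).length = l.length * n := by
  rw [List.length_flatMap, List.map_congr_left h]
  simp

theorem eq_of_flatMap_eq {ι : Type*} {f g : ι → List Bool} :
    ∀ l : List ι, (∀ x ∈ l, (f x).length = (g x).length) → l.flatMap f = l.flatMap g →
      ∀ x ∈ l, f x = g x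
  | [], _, _ => by simp
  | a :: l, hlen, h => by
    rw [List.flatMap_cons, List.flatMap_cons] at h
    obtain ⟨h1, h2⟩ := List.append_inj h (hlen a (by simp))
    have := eq_of_flatMap_eq l (fun x hx => hlen x (by simp [hx])) h2
    simpa [h1] using this

/-- The exclusive ors of consecutive words determine all words from any one of them. -/
theorem eq_of_exchange_eq {ι : Type*} {P P' : ι → List Bool} {n : ℕ}
    (hP : ∀ j, (P j).length = n) (hP' : ∀ j, (P' j).length = n) :
    ∀ G : List ι, (List.zipWith (fun j k => xorBits (P j) (P k)) G G.tail).flatten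
        = (List.zipWith (fun j k => xorBits (P' j) (P' k)) G G.tail).flatten →
      ∀ j ∈ G, ∀ k ∈ G, P k = P' k → P j = P' j
  | [], _ => by simp
  | [a], _ => by simp
  | a :: b :: l, h => by
    simp only [List.tail_cons, List.zipWith_cons_cons, List.flatten_cons] at h
    obtain ⟨h1, h2⟩ := List.append_inj h
      ((length_xorBits (hP a) (hP b)).trans (length_xorBits (hP' a) (hP' b)).symm)
    have ih := eq_of_exchange_eq hP hP' (b :: l) h2
    have hab : P a = P' a → P b = P' b := fun e => by
      rw [e] at h1
      exact eq_of_xorBits_eq ((hP b).trans (hP' a).symm) ((hP' b).trans (hP' a).symm) h1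
    have hba : P b = P' b → P a = P' a := fun e => by
      rw [e] at h1
      exact eq_of_xorBits_eq_right ((hP a).trans (hP' b).symm) ((hP' a).trans (hP' b).symm) h1
    intro j hj k hk e
    rcases List.mem_cons.1 hj with rfl | hj' <;> rcases List.mem_cons.1 hk with rfl | hk'
    · exact e
    · exact hba (ih b (by simp) k hk' e)
    · exact ih j hj' b (by simp) (hab e)
    · exact ih j hj' k hk' e

theorem length_exchange {ι : Type*} {P : ι → List Bool} {n : ℕ} (hP : ∀ j, (P j).length = n) :
    ∀ G : List ι, (List.zipWith (fun j k => xorBits (P j) (P k)) G G.tail).flatten.length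
      = (G.length - 1) * n
  | [] => by simp
  | [a] => by simp
  | a :: b :: l => by
    have ih := length_exchange hP (b :: l)
    simp only [List.tail_cons, List.zipWith_cons_cons, List.flatten_cons, List.length_append,
      List.length_cons, add_tsub_cancel_right] at ih ⊢
    rw [ih, length_xorBits (hP a) (hP b)]
    ring

theorem length_foldr_xorBits {ι : Type*} {P : ι → List Bool} {n : ℕ} (hP : ∀ j, (P j).length = n)
    (l : List ι) :
    (l.foldr (fun k acc => xorBits (P k) acc) (List.replicate n false)).length = n := by
  induction l with
  | nil => simp
  | cons a l ih => exact length_xorBits (hP a) ih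

/-- The exclusive or of words determines any one of them from the other ones. -/
theorem eq_of_foldr_xorBits_eq {ι : Type*} {P P' : ι → List Bool} {n : ℕ}
    (hP : ∀ j, (P j).length = n) (hP' : ∀ j, (P' j).length = n) (k : ι) :
    ∀ l : List ι, l.Nodup → k ∈ l → (∀ j ∈ l, j ≠ k → P j = P' j) →
      l.foldr (fun k acc => xorBits (P k) acc) (List.replicate n false)
        = l.foldr (fun k acc => xorBits (P' k) acc) (List.replicate n false) → P k = P' k
  | [], _, hk, _, _ => by simp at hk
  | a :: l, hl, hk, hne, h => by
    rw [List.nodup_cons] at hl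
    simp only [List.foldr_cons] at h
    have l1 := length_foldr_xorBits hP l
    have l2 := length_foldr_xorBits hP' l
    rcases List.mem_cons.1 hk with rfl | hk
    · have htail : l.foldr (fun k acc => xorBits (P k) acc) (List.replicate n false)
          = l.foldr (fun k acc => xorBits (P' k) acc) (List.replicate n false) :=
        List.foldr_ext _ _ _ fun j hj b => by
          rw [hne j (by simp [hj]) fun e => hl.1 (e ▸ hj)]
      rw [htail] at h
      exact eq_of_xorBits_eq_right ((hP k).trans l2.symm) ((hP' k).trans l2.symm) h
    · have hak : a ≠ k := fun e => hl.1 (e ▸ hk)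
      rw [hne a (by simp) hak] at h
      exact eq_of_foldr_xorBits_eq hP hP' k l hl.2 hk (fun j hj => hne j (by simp [hj]))
        (eq_of_xorBits_eq (l1.trans (hP' a).symm) (l2.trans (hP' a).symm) h)

theorem take_add_eq {l l' : List Bool} {m n : ℕ} (h : l.take m = l'.take m)
    (hs : slice l m n = slice l' m n) : l.take (m + n) = l'.take (m + n) := by
  rw [List.take_add, List.take_add, h]
  exact congrArg _ hs

theorem take_add_mul_eq {l l' : List Bool} {m n : ℕ} (h : l.take m = l'.take m) (K : ℕ)
    (hs : ∀ j < K, slice l (m + j * n) n = slice l' (m + j * n) n) :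
    l.take (m + K * n) = l'.take (m + K * n) := by
  induction K with
  | zero => simpa using h
  | succ K ih =>
    rw [add_mul, one_mul, ← add_assoc]
    exact take_add_eq (ih fun j hj => hs j (by omega)) (hs K (by omega))

/-! ### Decoding the proposed scheme -/

section Bitwise

variable {K : ℕ} {s : Split} {W0 W0' : List Bool} {W W' : Fin 2 → List Bool}

/-! ### Lengths of the cached and transmitted pieces -/

theorem length_codedPacket (h : ∀ i, K * s.a + K * s.q + s.v i ≤ (W i).length) (i : Fin 2)
    (j : Fin K) : (codedPacket s W i j).length = s.a := by
  refine length_slice ((?_ : _ ≤ K * s.a).trans (by have := h i; omega))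
  calc j * s.a + s.a = (j + 1) * s.a := by ring
    _ ≤ K * s.a := Nat.mul_le_mul_right _ j.2

theorem length_uncodedPacket (h : ∀ i, K * s.a + K * s.q + s.v i ≤ (W i).length) (i : Fin 2)
    (j : Fin K) : (uncodedPacket s W i j).length = s.q := by
  refine length_slice ((?_ : _ ≤ K * s.a + K * s.q).trans (by have := h i; omega))
  calc K * s.a + j * s.q + s.q = K * s.a + (j + 1) * s.q := by ring
    _ ≤ K * s.a + K * s.q := Nat.add_le_add_left (Nat.mul_le_mul_right _ j.2) _

theorem length_fullyCached (h : ∀ i, K * s.a + K * s.q + s.v i ≤ (W i).length) (i : Fin 2) :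
    (fullyCached s W K i).length = s.v i :=
  length_slice (h i)

theorem length_uncached (i : Fin 2) :
    (uncached s W K i).length = (W i).length - (K * s.a + K * s.q + s.v i) := by
  simp [uncached]

theorem length_cacheBits (h : ∀ i, K * s.a + K * s.q + s.v i ≤ (W i).length)
    (h0 : s.c ≤ W0.length) (k : Fin K) :
    (cacheBits s W0 W k).length = s.c + s.a + (K - 1) * (2 * s.q) + s.v 0 + s.v 1 := by
  have hG : ((List.finRange K).filter (· ≠ k)).length = K - 1 := by
    have := List.length_eq_length_filter_add (l := List.finRange K) (fun j => decide (j = k))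
    have h1 : ((List.finRange K).filter (fun j => decide (j = k))).length = 1 := by
      rw [← List.countP_eq_length_filter]
      exact List.count_eq_one_of_mem (List.nodup_finRange K) (List.mem_finRange k)
    simp only [List.length_finRange, h1] at this
    simp only [ne_eq, decide_not]
    omega
  simp only [cacheBits, List.length_append, length_fullyCached h, List.length_take,
    length_xorBits (length_codedPacket h 0 k) (length_codedPacket h 1 k)]
  rw [length_flatMap_const (n := 2 * s.q) _ fun j _ => by
    rw [List.length_append, length_uncodedPacket h, length_uncodedPacket h, two_mul], hG]
  omega

theorem length_uncodedDelivery (h : ∀ i, K * s.a + K * s.q + s.v i ≤ (W i).length)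
    (d : Demand K) : (uncodedDelivery s W d).length = s.q :=
  length_foldr_xorBits (P := fun k => uncodedPacket s W (d k) k)
    (fun k => length_uncodedPacket h _ k) _

/-- If x and y receivers request the two files, x + y = K, then K packets and (x - 1) + (y - 1)
exclusive ors are sent: 2K - 2 packets. Both x and y are positive, so the truncated subtractions are
genuine. -/
theorem length_codedDelivery_of_all (h : ∀ i, K * s.a + K * s.q + s.v i ≤ (W i).length)
    {d : Demand K} (hd : ∀ i, Requested d i) :
    (codedDelivery s W d).length + 2 * s.a = 2 * (K * s.a) := by
  have hG := List.length_eq_length_filter_add (l := List.finRange K) (fun k => decide (d k = 0))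
  have hne (k : Fin K) : (!decide (d k = 0)) = decide (d k = 1) := by
    rcases (by omega : d k = 0 ∨ d k = 1) with e | e <;> simp [e]
  simp only [List.length_finRange, hne] at hG
  have hpos (i : Fin 2) : 0 < ((List.finRange K).filter (fun k => decide (d k = i))).length := by
    obtain ⟨k, hk⟩ := hd i
    exact List.length_pos_of_mem (List.mem_filter.2 ⟨List.mem_finRange k, by simpa using hk⟩)
  rw [codedDelivery, if_pos hd]
  simp only [List.flatMap_cons, List.flatMap_nil, List.append_nil, List.length_append]
  rw [length_flatMap_const _ fun k _ => length_codedPacket h (1 - d k) k,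
    length_exchange (length_codedPacket h 0), length_exchange (length_codedPacket h 1),
    List.length_finRange]
  have p0 := hpos 0
  have p1 := hpos 1
  generalize ((List.finRange K).filter (fun k => decide (d k = 0))).length = x at *
  generalize ((List.finRange K).filter (fun k => decide (d k = 1))).length = y at *
  obtain ⟨x, rfl⟩ := Nat.exists_eq_add_of_lt p0
  obtain ⟨y, rfl⟩ := Nat.exists_eq_add_of_lt p1
  subst hG
  simp only [zero_add, add_tsub_cancel_right]
  ring

theorem length_codedDelivery_of_single (h : ∀ i, K * s.a + K * s.q + s.v i ≤ (W i).length)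
    {d : Demand K} {i : Fin 2} (hi : Requested d i) (hd : ¬ Requested d (1 - i)) :
    (codedDelivery s W d).length = K * s.a := by
  rw [codedDelivery, if_neg fun h => hd (h _)]
  have hlen (i) := length_flatMap_const (List.finRange K)
    fun k _ => length_codedPacket h i k
  fin_cases i
  · simp_all [List.flatMap_cons]
  · simp_all [List.flatMap_cons]

theorem length_sentBits_of_all (h : ∀ i, K * s.a + K * s.q + s.v i ≤ (W i).length)
    (h0 : s.c ≤ W0.length) {d : Demand K} (hd : ∀ i, Requested d i) :
    (sentBits s W0 W d).length + (s.c + 2 * s.a + 2 * (K * s.q) + s.v 0 + s.v 1)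
      = W0.length + (W 0).length + (W 1).length + s.q := by
  have h1 := length_codedDelivery_of_all h hd
  have h2 := h 0
  have h3 := h 1
  simp only [sentBits, List.flatMap_cons, List.flatMap_nil, List.append_nil, List.length_append,
    if_pos (hd _), length_uncached, length_uncodedDelivery h, List.length_drop]
  omega

theorem length_sentBits_of_single (h : ∀ i, K * s.a + K * s.q + s.v i ≤ (W i).length)
    (h0 : s.c ≤ W0.length) {d : Demand K} {i : Fin 2} (hi : Requested d i)
    (hd : ¬ Requested d (1 - i)) :
    (sentBits s W0 W d).length + (s.c + K * s.q + s.v i) = W0.length + (W i).length + s.q := by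
  have h1 := length_codedDelivery_of_single h hi hd
  have h2 := h i
  have h3 : ([0, 1].flatMap (fun i : Fin 2 => if Requested d i then uncached s W K i else []))
      = uncached s W K i := by
    fin_cases i
    · simp_all [List.flatMap_cons]
    · simp_all [List.flatMap_cons]
  simp only [sentBits, h3, List.length_append, length_uncached, length_uncodedDelivery h,
    List.length_drop, h1]
  omega

/-- A demand for both files is the worst case. The other file adds its `K * s.a` coded bits and its
uncached bits, while the coded exchange saves only `2 * s.a`, which is no more as K ≥ 2. -/
theorem length_sentBits_le (hK : 2 ≤ K) (h : ∀ i, K * s.a + K * s.q + s.v i ≤ (W i).length)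
    (h0 : s.c ≤ W0.length) (d : Demand K) :
    (sentBits s W0 W d).length + (s.c + 2 * s.a + 2 * (K * s.q) + s.v 0 + s.v 1)
      ≤ W0.length + (W 0).length + (W 1).length + s.q := by
  by_cases hd : ∀ i, Requested d i
  · exact (length_sentBits_of_all h h0 hd).le
  have hKa : 2 * s.a ≤ K * s.a := Nat.mul_le_mul_right _ hK
  have h1 := h 0
  have h2 := h 1
  obtain ⟨i, hi⟩ := not_forall.1 hd
  have hi' : Requested d (1 - i) := by
    refine ⟨⟨0, by omega⟩, ?_⟩
    have := not_exists.1 hi ⟨0, by omega⟩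
    omega
  have h3 := length_sentBits_of_single h h0 hi' (by rwa [sub_sub_cancel])
  fin_cases i
  · simp only [Fin.zero_eta, sub_zero] at h3
    omega
  · simp only [Fin.mk_one, sub_self] at h3
    omega

/-- The packets cached in coded form of the requested file are decoded. -/
theorem codedPacket_eq_of_codedDelivery_eq
    (h : ∀ i, K * s.a + K * s.q + s.v i ≤ (W i).length)
    (h' : ∀ i, K * s.a + K * s.q + s.v i ≤ (W' i).length) {k : Fin K} {d : Demand K}
    (hc : xorBits (codedPacket s W 0 k) (codedPacket s W 1 k)
      = xorBits (codedPacket s W' 0 k) (codedPacket s W' 1 k))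
    (hs : codedDelivery s W d = codedDelivery s W' d) (j : Fin K) :
    codedPacket s W (d k) j = codedPacket s W' (d k) j := by
  have hl := length_codedPacket (s := s) h
  have hl' := length_codedPacket (s := s) h'
  unfold codedDelivery at hs
  simp only [List.flatMap_cons, List.flatMap_nil, List.append_nil] at hs
  split_ifs at hs with hall h0 h1
  · obtain ⟨hs1, hs2⟩ := List.append_inj hs
      (length_flatMap_congr _ fun _ _ => (hl _ _).trans (hl' _ _).symm)
    have hother := fun j => eq_of_flatMap_eq _ (fun _ _ => (hl _ _).trans (hl' _ _).symm) hs1 j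
      (List.mem_finRange j)
    obtain ⟨hs3, hs4⟩ := List.append_inj hs2
      ((length_exchange (hl 0) _).trans (length_exchange (hl' 0) _).symm)
    -- The packet of receiver k from the file it does not request has been sent, so its cached
    -- exclusive or reveals its packet of the requested file.
    have hown : codedPacket s W (d k) k = codedPacket s W' (d k) k := by
      have ho := hother k
      rcases (by omega : d k = 0 ∨ d k = 1) with e | e
      · rw [e, sub_zero] at ho
        rw [ho] at hc
        rw [e]
        exact eq_of_xorBits_eq_right ((hl _ _).trans (hl' _ _).symm)
          ((hl' _ _).trans (hl' _ _).symm) hc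
      · rw [e, sub_self] at ho
        rw [ho] at hc
        rw [e]
        exact eq_of_xorBits_eq ((hl _ _).trans (hl' _ _).symm)
          ((hl' _ _).trans (hl' _ _).symm) hc
    -- Receivers with the same request are reached from k along the chain of exclusive ors; for the
    -- others, the packet of file `d k` is the one sent in the clear.
    by_cases hj : d j = d k
    · have mem (i) (hi : d i = d k) :
          i ∈ (List.finRange K).filter (fun m => decide (d m = d k)) :=
        List.mem_filter.2 ⟨List.mem_finRange i, by simpa using hi⟩
      refine eq_of_exchange_eq (hl _) (hl' _)
        ((List.finRange K).filter (fun m => decide (d m = d k))) ?_ j (mem j hj) k (mem k rfl) hown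
      rcases (by omega : d k = 0 ∨ d k = 1) with e | e <;> rw [e]
      · exact hs3
      · exact hs4
    · have := hother j
      rwa [show 1 - d j = d k by omega] at this
  -- Not both files are requested. The only consistent branch is the one that sends all packets of
  -- file `d k` in the clear.
  all_goals
    rcases (by omega : d k = 0 ∨ d k = 1) with e | e
  · exact absurd (fun i => by fin_cases i <;> assumption) hall
  · exact absurd (fun i => by fin_cases i <;> assumption) hall
  · rw [e]
    rw [List.append_nil, List.append_nil] at hs
    exact eq_of_flatMap_eq _ (fun _ _ => (hl _ _).trans (hl' _ _).symm) hs j (List.mem_finRange j)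
  · exact absurd ⟨k, e⟩ ‹¬ Requested d 1›
  · exact absurd ⟨k, e⟩ h0
  · rw [e]
    rw [List.nil_append, List.nil_append] at hs
    exact eq_of_flatMap_eq _ (fun _ _ => (hl _ _).trans (hl' _ _).symm) hs j (List.mem_finRange j)
  · exact absurd ⟨k, e⟩ h0
  · exact absurd ⟨k, e⟩ ‹¬ Requested d 1›

/-- The cache content and the codeword determine the requested descriptions. -/
theorem eq_of_cacheBits_eq_of_sentBits_eq
    (h : ∀ i, K * s.a + K * s.q + s.v i ≤ (W i).length) (h0 : W0.length = W0'.length)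
    (hW : ∀ i, (W i).length = (W' i).length) {k : Fin K} {d : Demand K}
    (hc : cacheBits s W0 W k = cacheBits s W0' W' k)
    (hs : sentBits s W0 W d = sentBits s W0' W' d) : W0 = W0' ∧ W (d k) = W' (d k) := by
  have h' : ∀ i, K * s.a + K * s.q + s.v i ≤ (W' i).length := fun i => (hW i) ▸ h i
  have hl := length_codedPacket (s := s) h
  have hl' := length_codedPacket (s := s) h'
  have hu := length_uncodedPacket (s := s) h
  have hu' := length_uncodedPacket (s := s) h'
  have hf := length_fullyCached (s := s) h
  have hf' := length_fullyCached (s := s) h'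
  -- Corresponding pieces have equal lengths in both libraries, so equal concatenations can be cut
  -- apart piece by piece.
  obtain ⟨hc, hv1⟩ := List.append_inj' hc ((hf _).trans (hf' _).symm)
  obtain ⟨hc, hv0⟩ := List.append_inj' hc ((hf _).trans (hf' _).symm)
  have hpair : ∀ j ∈ (List.finRange K).filter (· ≠ k),
      (uncodedPacket s W 0 j ++ uncodedPacket s W 1 j).length
        = (uncodedPacket s W' 0 j ++ uncodedPacket s W' 1 j).length := fun j _ => by
    simp only [List.length_append, hu, hu']
  obtain ⟨hc, hq⟩ := List.append_inj' hc (length_flatMap_congr _ hpair)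
  obtain ⟨hc0, hx⟩ := List.append_inj hc (by simp [h0])
  have hvd : fullyCached s W K (d k) = fullyCached s W' K (d k) := by
    rcases (by omega : d k = 0 ∨ d k = 1) with e | e <;> rw [e] <;> assumption
  have hqd : ∀ j, j ≠ k → ∀ i, uncodedPacket s W i j = uncodedPacket s W' i j := by
    intro j hj i
    have := eq_of_flatMap_eq _ hpair hq j
      (List.mem_filter.2 ⟨List.mem_finRange j, by simpa using hj⟩)
    obtain ⟨e0, e1⟩ := List.append_inj this ((hu _ _).trans (hu' _ _).symm)
    rcases (by omega : i = 0 ∨ i = 1) with e | e <;> rw [e] <;> assumption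
  have hunc : ∀ i ∈ [(0 : Fin 2), 1],
      (if Requested d i then uncached s W K i else []).length
        = (if Requested d i then uncached s W' K i else []).length := fun i _ => by
    split_ifs
    · rw [length_uncached, length_uncached, hW]
    · rfl
  obtain ⟨hs, hn⟩ := List.append_inj' hs (length_flatMap_congr _ hunc)
  obtain ⟨hs, hsq⟩ := List.append_inj' hs
    ((length_uncodedDelivery h d).trans (length_uncodedDelivery h' d).symm)
  obtain ⟨hs0, hsa⟩ := List.append_inj hs (by simp [h0])
  have hnd : uncached s W K (d k) = uncached s W' K (d k) := by
    have := eq_of_flatMap_eq _ hunc hn (d k) (by simp; omega)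
    rwa [if_pos ⟨k, rfl⟩, if_pos ⟨k, rfl⟩] at this
  have hqk : uncodedPacket s W (d k) k = uncodedPacket s W' (d k) k :=
    eq_of_foldr_xorBits_eq (P := fun k => uncodedPacket s W (d k) k)
      (P' := fun k => uncodedPacket s W' (d k) k) (fun _ => hu _ _) (fun _ => hu' _ _) k
      (List.finRange K) (List.nodup_finRange K) (List.mem_finRange k)
      (fun j _ hj => hqd j hj _) hsq
  have ha := codedPacket_eq_of_codedDelivery_eq h h' hx hsa
  constructor
  · rw [← List.take_append_drop s.c W0, ← List.take_append_drop s.c W0', hc0, hs0]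
  -- The file is reassembled as a growing prefix: coded packets, uncoded packets, fully cached part,
  -- uncached rest.
  · have t1 : (W (d k)).take (0 + K * s.a) = (W' (d k)).take (0 + K * s.a) :=
      take_add_mul_eq (by simp) K fun j hj => by
        rw [zero_add]
        exact ha ⟨j, hj⟩
    rw [zero_add] at t1
    have t2 := take_add_mul_eq (n := s.q) t1 K fun j hj => by
      by_cases e : (⟨j, hj⟩ : Fin K) = k
      · subst e
        exact hqk
      · exact hqd ⟨j, hj⟩ e (d k)
    have t3 := take_add_eq t2 hvd
    rw [← List.take_append_drop (K * s.a + K * s.q + s.v (d k)) (W (d k)), t3,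
      show (W (d k)).drop _ = (W' (d k)).drop _ from hnd, List.take_append_drop]

end Bitwise

/-! ### The memory allocation of the proposed scheme -/

section Allocation

variable {K : ℕ} {M μ : ℝ} {ρ : RateTuple}

theorem mul_gam (hK : 2 ≤ K) : K * gam K ρ = min ρ.rho1 ρ.rho2 := by
  have : (K : ℝ) ≠ 0 := by positivity
  unfold gam
  field_simp

theorem gam_nonneg (h1 : 0 ≤ ρ.rho1) (h2 : 0 ≤ ρ.rho2) : 0 ≤ gam K ρ :=
  div_nonneg (le_min h1 h2) (Nat.cast_nonneg K)

theorem mul_gam_le_priv (hK : 2 ≤ K) (i : Fin 2) : K * gam K ρ ≤ ρ.priv i := by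
  rw [mul_gam hK]
  fin_cases i
  · exact min_le_left _ _
  · exact min_le_right _ _

/-- This puts the corner points of memory sharing in order: it gives M* - γ_K ≥ γ_K. -/
theorem four_gam_le (hK : 2 ≤ K) (h1 : 0 ≤ ρ.rho1) (h2 : 0 ≤ ρ.rho2) :
    4 * gam K ρ ≤ ρ.rho1 + ρ.rho2 := by
  have a : K * gam K ρ ≤ ρ.rho1 := mul_gam_le_priv hK 0
  have b : K * gam K ρ ≤ ρ.rho2 := mul_gam_le_priv hK 1
  have c : (2 : ℝ) ≤ K := by exact_mod_cast hK
  have := mul_le_mul_of_nonneg_right c (gam_nonneg (K := K) h1 h2)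
  linarith

/-- The rate at which the private descriptions are delivered with private memory `μ`. -/
noncomputable def privateRate (K : ℕ) (ρ : RateTuple) (μ : ℝ) : ℝ :=
  (ρ.rho1 + ρ.rho2) * (1 - (weights K ρ μ).2.1 - (weights K ρ μ).2.2)
    - 2 * ((weights K ρ μ).1 * gam K ρ) + (weights K ρ μ).2.1 * gam K ρ

/-- The limiting peak rate of the proposed scheme. -/
noncomputable def limitRate (K : ℕ) (M : ℝ) (ρ : RateTuple) : ℝ :=
  ρ.rho0 - commonMem K M ρ + privateRate K ρ (privateMem K M ρ)

/-- Fractions of the library served by the schemes of memory sharing, using private memory `μ`. -/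
structure IsSharing (K : ℕ) (ρ : RateTuple) (μ : ℝ) (θ : ℝ × ℝ × ℝ) : Prop where
  nonneg1 : 0 ≤ θ.1
  nonneg2 : 0 ≤ θ.2.1
  nonneg3 : 0 ≤ θ.2.2
  le_one : θ.1 + θ.2.1 + θ.2.2 ≤ 1
  memory : θ.1 * gam K ρ + θ.2.1 * threshold K ρ + θ.2.2 * (ρ.rho1 + ρ.rho2) = μ

theorem weights_isSharing (hK : 2 ≤ K) (h1 : 0 ≤ ρ.rho1) (h2 : 0 ≤ ρ.rho2) (hμ : 0 ≤ μ)
    (hμ' : μ ≤ ρ.rho1 + ρ.rho2) : IsSharing K ρ μ (weights K ρ μ) := by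
  have hg := gam_nonneg (K := K) h1 h2
  have h4 := four_gam_le hK h1 h2
  unfold weights
  split_ifs with ha hb
  · have hpos : 0 < gam K ρ := by linarith
    refine ⟨by positivity, le_rfl, le_rfl, ?_, ?_⟩
    · simpa using div_le_one_of_le₀ ha.le hg
    · field_simp
      simp
  · have hpos : 0 < threshold K ρ - gam K ρ := by linarith
    have ht : (μ - gam K ρ) / (threshold K ρ - gam K ρ) ≤ 1 :=
      div_le_one_of_le₀ (by linarith) hpos.le
    refine ⟨by simpa using ht, div_nonneg (by linarith) hpos.le, le_rfl, by simp, ?_⟩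
    field_simp
    ring
  · have hd : threshold K ρ = ρ.rho1 + ρ.rho2 - 2 * gam K ρ := rfl
    have ht : (μ - threshold K ρ) / (2 * gam K ρ) ≤ 1 :=
      div_le_one_of_le₀ (by linarith) (by linarith)
    refine ⟨le_rfl, by simpa using ht, div_nonneg (by linarith) (by linarith), by simp, ?_⟩
    -- If γ_K = 0, the quotient is 0 by convention; the third and fourth schemes then use the same
    -- memory, so the memory identity still holds.
    rcases hg.eq_or_lt with h | h
    · simp only [← h, mul_zero, div_zero]
      linarith
    · simp only
      have : (μ - threshold K ρ) / (2 * gam K ρ) * (2 * gam K ρ) = μ - threshold K ρ := by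
        field_simp
      linear_combination this - (μ - threshold K ρ) / (2 * gam K ρ) * hd

theorem privateRate_of_lt_gam (h : μ < gam K ρ) (hμ : 0 ≤ μ) :
    privateRate K ρ μ = ρ.rho1 + ρ.rho2 - 2 * μ := by
  have : gam K ρ ≠ 0 := by linarith
  simp only [privateRate, weights, if_pos h]
  field_simp
  ring

theorem privateRate_of_lt_threshold (h : gam K ρ ≤ μ) (h' : μ < threshold K ρ) :
    privateRate K ρ μ = ρ.rho1 + ρ.rho2 - gam K ρ - μ := by
  have : threshold K ρ - gam K ρ ≠ 0 := by linarith
  simp only [privateRate, weights, if_neg h.not_gt, if_pos h']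
  have hd : threshold K ρ = ρ.rho1 + ρ.rho2 - 2 * gam K ρ := rfl
  have ht : (μ - gam K ρ) / (threshold K ρ - gam K ρ) * (threshold K ρ - gam K ρ)
      = μ - gam K ρ := by field_simp
  linear_combination -ht + (μ - gam K ρ) / (threshold K ρ - gam K ρ) * hd

theorem privateRate_of_threshold_le (hK : 2 ≤ K) (h1 : 0 ≤ ρ.rho1) (h2 : 0 ≤ ρ.rho2)
    (h : threshold K ρ ≤ μ) (h' : μ ≤ ρ.rho1 + ρ.rho2) :
    privateRate K ρ μ = (ρ.rho1 + ρ.rho2 - μ) / 2 := by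
  have h4 := four_gam_le hK h1 h2
  have hd : threshold K ρ = ρ.rho1 + ρ.rho2 - 2 * gam K ρ := rfl
  have hg := gam_nonneg (K := K) h1 h2
  have hle : gam K ρ ≤ μ := by linarith
  simp only [privateRate, weights, if_neg hle.not_gt, if_neg h.not_gt]
  rcases hg.eq_or_lt with hg | hg
  · simp only [← hg, mul_zero, div_zero]
    linarith
  · have ht : (μ - threshold K ρ) / (2 * gam K ρ) * (2 * gam K ρ) = μ - threshold K ρ := by
      field_simp
    linear_combination -ht / 2 + hd / 2

theorem threshold_nonneg (hK : 2 ≤ K) (h1 : 0 ≤ ρ.rho1) (h2 : 0 ≤ ρ.rho2) :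
    0 ≤ threshold K ρ := by
  have h4 := four_gam_le hK h1 h2
  have hg := gam_nonneg (K := K) h1 h2
  unfold threshold
  linarith

theorem commonMem_mem_Icc (h0 : 0 ≤ ρ.rho0) : commonMem K M ρ ∈ Set.Icc 0 ρ.rho0 := by
  unfold commonMem
  split_ifs <;> constructor <;> linarith

theorem privateMem_mem_Icc (hK : 2 ≤ K) (h1 : 0 ≤ ρ.rho1) (h2 : 0 ≤ ρ.rho2) (hM : 0 ≤ M) :
    privateMem K M ρ ∈ Set.Icc 0 (ρ.rho1 + ρ.rho2) := by
  have ht := threshold_nonneg hK h1 h2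
  have hg := gam_nonneg (K := K) h1 h2
  have hd : threshold K ρ = ρ.rho1 + ρ.rho2 - 2 * gam K ρ := rfl
  unfold privateMem
  split_ifs
  · constructor <;> linarith
  · constructor <;> linarith
  · exact ⟨le_min (by linarith) (by linarith), min_le_right _ _⟩

theorem commonMem_add_privateMem_le : commonMem K M ρ + privateMem K M ρ ≤ M := by
  unfold commonMem privateMem
  split_ifs
  · linarith
  · linarith
  · linarith [min_le_left (M - ρ.rho0) (ρ.rho1 + ρ.rho2)]

theorem limitRate_of_lt_gam (hK : 2 ≤ K) (h1 : 0 ≤ ρ.rho1) (h2 : 0 ≤ ρ.rho2) (hM : 0 ≤ M)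
    (h : M < gam K ρ) : limitRate K M ρ = ρ.rho0 + ρ.rho1 + ρ.rho2 - 2 * M := by
  have h4 := four_gam_le hK h1 h2
  have hlt : M < threshold K ρ := by
    unfold threshold
    linarith
  rw [limitRate, commonMem, privateMem, if_pos hlt, if_pos hlt, privateRate_of_lt_gam h hM]
  ring

/-- One formula covers two regimes: sharing between the second and third schemes, and caching the
common description, both save one bit of rate per bit of memory. -/
theorem limitRate_of_lt (hK : 2 ≤ K) (h1 : 0 ≤ ρ.rho1) (h2 : 0 ≤ ρ.rho2)
    (h : gam K ρ ≤ M) (h' : M < ρ.rho0 + threshold K ρ) :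
    limitRate K M ρ = ρ.rho0 + ρ.rho1 + ρ.rho2 - gam K ρ - M := by
  have hg := gam_nonneg (K := K) h1 h2
  have hd : threshold K ρ = ρ.rho1 + ρ.rho2 - 2 * gam K ρ := rfl
  rw [limitRate, commonMem, privateMem]
  split_ifs with hlt
  · rw [privateRate_of_lt_threshold h hlt]
    ring
  · rw [privateRate_of_threshold_le hK h1 h2 le_rfl (by linarith)]
    linarith

theorem limitRate_of_le (hK : 2 ≤ K) (h0 : 0 ≤ ρ.rho0) (h1 : 0 ≤ ρ.rho1) (h2 : 0 ≤ ρ.rho2)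
    (h : ρ.rho0 + threshold K ρ ≤ M) :
    limitRate K M ρ = (ρ.rho0 + ρ.rho1 + ρ.rho2 - min M (ρ.rho0 + ρ.rho1 + ρ.rho2)) / 2 := by
  have hg := gam_nonneg (K := K) h1 h2
  have hd : threshold K ρ = ρ.rho1 + ρ.rho2 - 2 * gam K ρ := rfl
  have hle : threshold K ρ ≤ M := by linarith
  rw [limitRate, commonMem, privateMem, if_neg hle.not_gt, if_neg h.not_gt, if_neg hle.not_gt,
    if_neg h.not_gt, privateRate_of_threshold_le hK h1 h2 (le_min (by linarith) (by linarith))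
    (min_le_right _ _)]
  have : min M (ρ.rho0 + ρ.rho1 + ρ.rho2) = ρ.rho0 + min (M - ρ.rho0) (ρ.rho1 + ρ.rho2) := by
    rw [← min_add_add_left]
    congr 1 <;> ring
  rw [this]
  ring

end Allocation

/-! ### Error probability and peak rate of the proposed scheme -/

section Scheme

variable {K : ℕ} {M : ℝ} {ρ : RateTuple}

theorem nbits_le (F : ℕ) {r : ℝ} (hr : 0 ≤ r) : (nbits F r : ℝ) ≤ F * r :=
  Nat.floor_le (by positivity)

theorem nbits_mono (F : ℕ) {r r' : ℝ} (h : r ≤ r') : nbits F r ≤ nbits F r' :=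
  Nat.floor_mono (by gcongr)

variable (hK : 2 ≤ K) (h0 : 0 ≤ ρ.rho0) (h1 : 0 ≤ ρ.rho1) (h2 : 0 ≤ ρ.rho2) (hM : 0 ≤ M) (F : ℕ)

theorem priv_nonneg (h1 : 0 ≤ ρ.rho1) (h2 : 0 ≤ ρ.rho2) (i : Fin 2) : 0 ≤ ρ.priv i := by
  fin_cases i
  · exact h1
  · exact h2

theorem IsSharing.excess_nonneg {μ : ℝ} {θ : ℝ × ℝ × ℝ} (hθ : IsSharing K ρ μ θ) (hK : 2 ≤ K)
    (h1 : 0 ≤ ρ.rho1) (h2 : 0 ≤ ρ.rho2) (i : Fin 2) :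
    0 ≤ θ.2.1 * (ρ.priv i - K * gam K ρ) + θ.2.2 * ρ.priv i :=
  add_nonneg (mul_nonneg hθ.nonneg2 (sub_nonneg.2 (mul_gam_le_priv hK i)))
    (mul_nonneg hθ.nonneg3 (priv_nonneg h1 h2 i))

include hK h1 h2 hM in
-- The sharing fractions sum to at most one and K γ_K ≤ ρᵢ, so the unrounded pieces fit; rounding
-- each one down preserves this.
theorem proposedSplit_fits (i : Fin 2) :
    K * (proposedSplit K M ρ F).a + K * (proposedSplit K M ρ F).q + (proposedSplit K M ρ F).v i
      ≤ nbits F (ρ.priv i) := by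
  have hμ := privateMem_mem_Icc hK h1 h2 hM
  have hθ := weights_isSharing hK h1 h2 hμ.1 hμ.2
  have hg := gam_nonneg (K := K) h1 h2
  simp only [proposedSplit]
  have hv := hθ.excess_nonneg hK h1 h2 i
  generalize weights K ρ (privateMem K M ρ) = θ at *
  refine Nat.le_floor ?_
  push_cast
  have a := nbits_le F (mul_nonneg hθ.nonneg1 hg)
  have b := nbits_le F (mul_nonneg hθ.nonneg2 hg)
  have c := nbits_le F hv
  have hle : θ.1 * (K * gam K ρ) + (θ.2.1 + θ.2.2) * ρ.priv i ≤ ρ.priv i := by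
    have := mul_le_mul_of_nonneg_left (mul_gam_le_priv (ρ := ρ) hK i) hθ.nonneg1
    have := mul_le_mul_of_nonneg_right hθ.le_one (priv_nonneg h1 h2 i)
    linarith
  calc _ ≤ K * (F * (θ.1 * gam K ρ)) + K * (F * (θ.2.1 * gam K ρ))
        + F * (θ.2.1 * (ρ.priv i - K * gam K ρ) + θ.2.2 * ρ.priv i) := by gcongr
    _ = F * (θ.1 * (K * gam K ρ) + (θ.2.1 + θ.2.2) * ρ.priv i) := by ring
    _ ≤ F * ρ.priv i := by gcongr

include h0 in
theorem proposedSplit_common_le : (proposedSplit K M ρ F).c ≤ nbits F ρ.rho0 :=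
  nbits_mono F (commonMem_mem_Icc h0).2

include hK h0 h1 h2 hM in
theorem proposedSplit_memory_le :
    (proposedSplit K M ρ F).c + (proposedSplit K M ρ F).a
      + (K - 1) * (2 * (proposedSplit K M ρ F).q) + (proposedSplit K M ρ F).v 0
      + (proposedSplit K M ρ F).v 1 ≤ nbits F M := by
  have hμ := privateMem_mem_Icc hK h1 h2 hM
  have hθ := weights_isSharing hK h1 h2 hμ.1 hμ.2
  have hg := gam_nonneg (K := K) h1 h2
  have hcm := commonMem_add_privateMem_le (K := K) (M := M) (ρ := ρ)
  simp only [proposedSplit]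
  have hv0 := hθ.excess_nonneg hK h1 h2 0
  have hv1 := hθ.excess_nonneg hK h1 h2 1
  generalize weights K ρ (privateMem K M ρ) = θ at *
  refine Nat.le_floor ?_
  push_cast [Nat.cast_sub (show 1 ≤ K by omega)]
  have a := nbits_le F (mul_nonneg hθ.nonneg1 hg)
  have b := nbits_le F (mul_nonneg hθ.nonneg2 hg)
  have c0 := nbits_le F hv0
  have c1 := nbits_le F hv1
  have e := nbits_le F (commonMem_mem_Icc (K := K) (M := M) h0).1
  have hK1 : (0 : ℝ) ≤ K - 1 := by
    have : (2 : ℝ) ≤ K := by exact_mod_cast hK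
    linarith
  have hmem := hθ.memory
  simp only [threshold] at hmem
  calc _ ≤ F * commonMem K M ρ + F * (θ.1 * gam K ρ) + (K - 1) * (2 * (F * (θ.2.1 * gam K ρ)))
        + F * (θ.2.1 * (ρ.priv 0 - K * gam K ρ) + θ.2.2 * ρ.priv 0)
        + F * (θ.2.1 * (ρ.priv 1 - K * gam K ρ) + θ.2.2 * ρ.priv 1) := by gcongr
    -- Under uncoded placement, 2(K - 1) packets of rate γ_K and both excess parts amount to M*.
    _ = F * (commonMem K M ρ + privateMem K M ρ) := by
      rw [show ρ.priv 0 = ρ.rho1 from rfl, show ρ.priv 1 = ρ.rho2 from rfl]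
      linear_combination F * hmem
    _ ≤ F * M := by gcongr

include hK h0 h1 h2 hM in
theorem proposedScheme_not_fails (d : Demand K) (w : Library ρ F) :
    ¬ (proposedScheme K M ρ F).Fails d w := by
  rintro ⟨k, hk⟩
  refine hk ?_
  set S := proposedScheme K M ρ F with hS
  -- The true library is a consistent candidate, so the choice operator does return a consistent
  -- one.
  have hspec : ∃ w' : Library ρ F, S.cacheEnc k w' = S.cacheEnc k w
      ∧ S.codeword d w' = S.codeword d w
      ∧ S.decoder k d (S.codeword d w) (S.cacheEnc k w) = (w'.1, w'.2 (d k)) :=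
    Classical.epsilon_spec (p := fun x => ∃ w' : Library ρ F, S.cacheEnc k w' = S.cacheEnc k w
      ∧ S.codeword d w' = S.codeword d w ∧ x = (w'.1, w'.2 (d k))) ⟨_, w, rfl, rfl, rfl⟩
  obtain ⟨w', hZ, hY, hx⟩ := hspec
  rw [hx]
  have hfit (w : Library ρ F) (i : Fin 2) : K * (proposedSplit K M ρ F).a
      + K * (proposedSplit K M ρ F).q + (proposedSplit K M ρ F).v i
      ≤ (List.ofFn (w.2 i)).length := by
    simpa using proposedSplit_fits hK h1 h2 hM F i
  have hcache (w : Library ρ F) := length_cacheBits (W0 := List.ofFn w.1) (hfit w)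
    (by simpa using proposedSplit_common_le h0 F) k
  -- The content fits into the cache, so nothing is truncated and padding loses no information.
  have hZ' : cacheBits (proposedSplit K M ρ F) (List.ofFn w'.1) (fun i => List.ofFn (w'.2 i)) k
      = cacheBits (proposedSplit K M ρ F) (List.ofFn w.1) (fun i => List.ofFn (w.2 i)) k := by
    refine List.ext_getElem ((hcache w').trans (hcache w).symm) fun i a b => ?_
    have hi : i < nbits F M :=
      (a.trans_eq (hcache w')).trans_le (proposedSplit_memory_le hK h0 h1 h2 hM F)
    have := congrFun hZ ⟨i, hi⟩
    simpa only [hS, proposedScheme, List.getD_eq_getElem _ _ a, List.getD_eq_getElem _ _ b]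
      using this
  obtain ⟨e0, e1⟩ := eq_of_cacheBits_eq_of_sentBits_eq (hfit w') (by simp) (fun i => by simp)
    hZ' hY
  exact Prod.ext (List.ofFn_injective e0) (List.ofFn_injective e1)

include hK h0 h1 h2 hM in
theorem proposedScheme_errorProb : (proposedScheme K M ρ F).errorProb = 0 := by
  have (d : Demand K) : IsEmpty {w : Library ρ F // (proposedScheme K M ρ F).Fails d w} :=
    ⟨fun w => proposedScheme_not_fails hK h0 h1 h2 hM F d w.1 w.2⟩
  simp [MRScheme.errorProb]

/-- The length of the longest codeword of the proposed scheme. -/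
noncomputable def proposedLength (K : ℕ) (M : ℝ) (ρ : RateTuple) (F : ℕ) : ℝ :=
  libraryBits ρ F + (proposedSplit K M ρ F).q - ((proposedSplit K M ρ F).c
    + 2 * (proposedSplit K M ρ F).a + 2 * (K * (proposedSplit K M ρ F).q)
    + (proposedSplit K M ρ F).v 0 + (proposedSplit K M ρ F).v 1)

include hK h0 h1 h2 hM in
theorem proposedScheme_peakRate :
    (proposedScheme K M ρ F).peakRate = proposedLength K M ρ F / F := by
  have hfit (w : Library ρ F) (i : Fin 2) : K * (proposedSplit K M ρ F).a
      + K * (proposedSplit K M ρ F).q + (proposedSplit K M ρ F).v i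
      ≤ (List.ofFn (w.2 i)).length := by
    simpa using proposedSplit_fits hK h1 h2 hM F i
  have hc (w : Library ρ F) : (proposedSplit K M ρ F).c ≤ (List.ofFn w.1).length := by
    simpa using proposedSplit_common_le h0 F
  have hle (d : Demand K) (w : Library ρ F) :
      (((proposedScheme K M ρ F).codeword d w).length : ℝ) ≤ proposedLength K M ρ F := by
    have h := length_sentBits_le hK (hfit w) (hc w) d
    simp only [List.length_ofFn] at h
    rw [proposedLength, le_sub_iff_add_le]
    exact_mod_cast h
  let d₀ : Demand K := fun k => if k = ⟨0, by omega⟩ then 0 else 1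
  have hd₀ : ∀ i, Requested d₀ i := fun i => by
    rcases (by omega : i = 0 ∨ i = 1) with rfl | rfl
    · exact ⟨⟨0, by omega⟩, by simp [d₀]⟩
    · exact ⟨⟨1, by omega⟩, by simp [d₀]⟩
  have heq (w : Library ρ F) :
      (((proposedScheme K M ρ F).codeword d₀ w).length : ℝ) = proposedLength K M ρ F := by
    have h := length_sentBits_of_all (hfit w) (hc w) hd₀
    simp only [List.length_ofFn] at h
    rw [proposedLength, eq_sub_iff_add_eq]
    exact_mod_cast h
  have hN : (0 : ℝ) < Nat.card (Library ρ F) := by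
    rw [Nat.card_eq_fintype_card]
    positivity
  have : Nonempty (Demand K) := ⟨d₀⟩
  refine le_antisymm (ciSup_le fun d => ?_) ?_
  · gcongr
    rw [div_le_iff₀' hN]
    refine (Finset.sum_le_sum fun w _ => hle d w).trans (le_of_eq ?_)
    simp [Nat.card_eq_fintype_card]
  · refine le_of_eq_of_le ?_ (le_ciSup (f := fun d => (∑ w : Library ρ F,
      (((proposedScheme K M ρ F).codeword d w).length : ℝ)) / Nat.card (Library ρ F) / F)
      (Set.finite_range _).bddAbove d₀)
    simp only [heq, Finset.sum_const, Finset.card_univ, nsmul_eq_mul]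
    rw [← Nat.card_eq_fintype_card, mul_div_cancel_left₀ _ hN.ne']

include hK h0 h1 h2 hM in
theorem tendsto_peakRate :
    Tendsto (fun F => (proposedScheme K M ρ F).peakRate) atTop (𝓝 (limitRate K M ρ)) := by
  have hμ := privateMem_mem_Icc hK h1 h2 hM
  have hθ := weights_isSharing hK h1 h2 hμ.1 hμ.2
  have hg := gam_nonneg (K := K) h1 h2
  have t0 := tendsto_nbits_div h0
  have t1 := tendsto_nbits_div h1
  have t2 := tendsto_nbits_div h2
  have tc := tendsto_nbits_div (commonMem_mem_Icc (K := K) (M := M) h0).1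
  have ta := tendsto_nbits_div (mul_nonneg hθ.nonneg1 hg)
  have tq := tendsto_nbits_div (mul_nonneg hθ.nonneg2 hg)
  have tv0 := tendsto_nbits_div (hθ.excess_nonneg hK h1 h2 0)
  have tv1 := tendsto_nbits_div (hθ.excess_nonneg hK h1 h2 1)
  have key := ((((t0.add t1).add t2).add tq).sub ((((tc.add (ta.const_mul 2)).add
    ((tq.const_mul (K : ℝ)).const_mul 2)).add tv0).add tv1))
  refine (key.congr fun F => ?_).trans (le_of_eq (congrArg _ ?_))
  · rw [proposedScheme_peakRate hK h0 h1 h2 hM, proposedLength]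
    simp only [libraryBits, proposedSplit]
    push_cast
    ring
  · rw [show ρ.priv 0 = ρ.rho1 from rfl, show ρ.priv 1 = ρ.rho2 from rfl, limitRate, privateRate]
    ring

include hK h0 h1 h2 hM in
theorem proposedPeakRate_eq : proposedPeakRate K M ρ = limitRate K M ρ :=
  (tendsto_peakRate hK h0 h1 h2 hM).limsup_eq

include hK h0 h1 h2 hM in
theorem limitRate_mem_region : (limitRate K M ρ, M) ∈ region K ρ := by
  refine subset_closure ⟨hM, proposedScheme K M ρ, ?_, le_of_eq ?_⟩
  · simp only [proposedScheme_errorProb hK h0 h1 h2 hM, tendsto_const_nhds]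
  · exact ((continuous_coe_real_ereal.tendsto _).comp
      (tendsto_peakRate hK h0 h1 h2 hM)).limsup_eq

/-! ### Comparison of the scheme with the converse -/

include hK h0 h1 h2 hM in
theorem optimalPeakRate_le : optimalPeakRate K M ρ ≤ limitRate K M ρ :=
  csInf_le ⟨0, fun _ hR => (rateBounds_of_mem_region hK h0 h1 h2 hR).nonneg⟩
    (limitRate_mem_region hK h0 h1 h2 hM)

include hK h0 h1 h2 hM in
theorem le_optimalPeakRate {b : ℝ} (h : ∀ R, RateBounds ρ R M → b ≤ R) :
    b ≤ optimalPeakRate K M ρ :=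
  le_csInf ⟨_, limitRate_mem_region hK h0 h1 h2 hM⟩
    fun R hR => h R (rateBounds_of_mem_region hK h0 h1 h2 hR)

include hK h0 h1 h2 in
theorem limitRate_eq_optimalPeakRate_of_le_gam (hM : 0 ≤ M) (h : M ≤ gam K ρ) :
    limitRate K M ρ = optimalPeakRate K M ρ := by
  refine le_antisymm (le_optimalPeakRate hK h0 h1 h2 hM fun R hR => ?_)
    (optimalPeakRate_le hK h0 h1 h2 hM)
  have h4 := four_gam_le hK h1 h2
  have hd : threshold K ρ = ρ.rho1 + ρ.rho2 - 2 * gam K ρ := rfl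
  have hb := hR.two_caches
  rcases h.lt_or_eq with hlt | rfl
  · rw [limitRate_of_lt_gam hK h1 h2 hM hlt]
    linarith
  · rcases lt_or_ge (gam K ρ) (ρ.rho0 + threshold K ρ) with hlt | hge
    · rw [limitRate_of_lt hK h1 h2 le_rfl hlt]
      linarith
    -- Here γ_K ≥ ρ₀ + M* together with 4 γ_K ≤ ρ₁ + ρ₂ forces all rates to vanish.
    · rw [limitRate_of_le hK h0 h1 h2 hge, min_eq_left (by linarith)]
      linarith

include hK h0 h1 h2 in
theorem limitRate_eq_optimalPeakRate_of_le (hM : 0 ≤ M) (h : ρ.rho0 + threshold K ρ ≤ M) :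
    limitRate K M ρ = optimalPeakRate K M ρ := by
  refine le_antisymm (le_optimalPeakRate hK h0 h1 h2 hM fun R hR => ?_)
    (optimalPeakRate_le hK h0 h1 h2 hM)
  have hb := hR.one_cache
  have hn := hR.nonneg
  rw [limitRate_of_le hK h0 h1 h2 h]
  rcases min_cases M (ρ.rho0 + ρ.rho1 + ρ.rho2) with ⟨e, -⟩ | ⟨e, -⟩ <;> rw [e] <;> linarith

include hK h0 h1 h2 in
theorem limitRate_sub_optimalPeakRate_le (hM : 0 ≤ M) (h : gam K ρ ≤ M)
    (h' : M < ρ.rho0 + threshold K ρ) :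
    limitRate K M ρ - optimalPeakRate K M ρ ≤ min ρ.rho1 ρ.rho2 / 2 - gam K ρ := by
  rw [sub_le_comm]
  refine le_optimalPeakRate hK h0 h1 h2 hM fun R hR => ?_
  have hb := hR.two_transmissions
  rw [limitRate_of_lt hK h1 h2 h h']
  linarith

end Scheme

end MRCaching

theorem mainTheorem6 (K : ℕ) (hK : 2 ≤ K) (ρ : MRCaching.RateTuple)
    (h0 : 0 ≤ ρ.rho0) (h1 : 0 ≤ ρ.rho1) (h2 : 0 ≤ ρ.rho2) :
    -- the proposed scheme is a reliable MR scheme of peak rate `proposedPeakRate`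
    (∀ M : ℝ, 0 ≤ M →
      Tendsto (fun F => (MRCaching.proposedScheme K M ρ F).errorProb) atTop (𝓝 0) ∧
      Tendsto (fun F => (MRCaching.proposedScheme K M ρ F).peakRate) atTop
        (𝓝 (MRCaching.proposedPeakRate K M ρ)) ∧
      MRCaching.optimalPeakRate K M ρ ≤ MRCaching.proposedPeakRate K M ρ) ∧
    -- it is optimal for small and for large cache capacities
    (∀ M ∈ Set.Icc 0 (1 / (K : ℝ) * min ρ.rho1 ρ.rho2) ∪
        Set.Icc (ρ.rho0 + ρ.rho1 + ρ.rho2 - 2 / (K : ℝ) * min ρ.rho1 ρ.rho2)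
          (ρ.rho0 + ρ.rho1 + ρ.rho2),
      MRCaching.proposedPeakRate K M ρ = MRCaching.optimalPeakRate K M ρ) ∧
    -- it is near-optimal for all other cache capacities
    (∀ M : ℝ, 0 ≤ M →
      M ∉ Set.Icc 0 (1 / (K : ℝ) * min ρ.rho1 ρ.rho2) ∪
        Set.Icc (ρ.rho0 + ρ.rho1 + ρ.rho2 - 2 / (K : ℝ) * min ρ.rho1 ρ.rho2)
          (ρ.rho0 + ρ.rho1 + ρ.rho2) →
      MRCaching.proposedPeakRate K M ρ - MRCaching.optimalPeakRate K M ρ ≤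
        (1 / 2 - 1 / (K : ℝ)) * min ρ.rho1 ρ.rho2) ∧
    -- for two receivers it is optimal for all cache capacities
    (K = 2 → ∀ M : ℝ, 0 ≤ M →
      MRCaching.proposedPeakRate K M ρ = MRCaching.optimalPeakRate K M ρ) := by
  have hK' : (2 : ℝ) ≤ K := by exact_mod_cast hK
  have hg : 1 / (K : ℝ) * min ρ.rho1 ρ.rho2 = MRCaching.gam K ρ := by
    rw [MRCaching.gam]
    ring
  have hthr : ρ.rho0 + ρ.rho1 + ρ.rho2 - 2 / (K : ℝ) * min ρ.rho1 ρ.rho2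
      = ρ.rho0 + MRCaching.threshold K ρ := by
    rw [MRCaching.threshold, ← hg]
    ring
  have hgap : (1 / 2 - 1 / (K : ℝ)) * min ρ.rho1 ρ.rho2
      = min ρ.rho1 ρ.rho2 / 2 - MRCaching.gam K ρ := by
    rw [← hg]
    ring
  have hgap_nonneg : 0 ≤ (1 / 2 - 1 / (K : ℝ)) * min ρ.rho1 ρ.rho2 :=
    mul_nonneg (sub_nonneg.2 (one_div_le_one_div_of_le two_pos hK')) (le_min h1 h2)
  have hpeak (M : ℝ) (hM : 0 ≤ M) := MRCaching.proposedPeakRate_eq hK h0 h1 h2 hM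
  have hle (M : ℝ) (hM : 0 ≤ M) := MRCaching.optimalPeakRate_le hK h0 h1 h2 hM
  -- The gap bound is proved for every M ≥ 0, so that for K = 2, where it is zero, it gives
  -- optimality everywhere.
  have hgap_le (M : ℝ) (hM : 0 ≤ M) :
      MRCaching.limitRate K M ρ - MRCaching.optimalPeakRate K M ρ
        ≤ (1 / 2 - 1 / (K : ℝ)) * min ρ.rho1 ρ.rho2 := by
    rcases le_total M (MRCaching.gam K ρ) with ha | ha
    · rwa [MRCaching.limitRate_eq_optimalPeakRate_of_le_gam hK h0 h1 h2 hM ha, sub_self]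
    rcases lt_or_ge M (ρ.rho0 + MRCaching.threshold K ρ) with hb | hb
    · rw [hgap]
      exact MRCaching.limitRate_sub_optimalPeakRate_le hK h0 h1 h2 hM ha hb
    · rwa [MRCaching.limitRate_eq_optimalPeakRate_of_le hK h0 h1 h2 hM hb, sub_self]
  refine ⟨fun M hM => ⟨?_, ?_, ?_⟩, ?_, fun M hM _ => ?_, ?_⟩
  · simp only [MRCaching.proposedScheme_errorProb hK h0 h1 h2 hM, tendsto_const_nhds]
  · rw [hpeak M hM]
    exact MRCaching.tendsto_peakRate hK h0 h1 h2 hM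
  · rw [hpeak M hM]
    exact hle M hM
  · rw [hg, hthr]
    rintro M (⟨hM, h⟩ | ⟨h, -⟩)
    · rw [hpeak M hM]
      exact MRCaching.limitRate_eq_optimalPeakRate_of_le_gam hK h0 h1 h2 hM h
    · have hM : 0 ≤ M := (add_nonneg h0 (MRCaching.threshold_nonneg hK h1 h2)).trans h
      rw [hpeak M hM]
      exact MRCaching.limitRate_eq_optimalPeakRate_of_le hK h0 h1 h2 hM h
  · rw [hpeak M hM]
    exact hgap_le M hM
  · rintro rfl M hM
    have h := hgap_le M hM
    norm_num at h
    rw [hpeak M hM]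
    exact le_antisymm h (hle M hM)
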